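/- Let $G=(V,E,\mathbf w)$ be a finite simple undirected planar graph with at least one edge and with positive integral edge weights $\mathbf w:E\to\mathbb N_+$, and let $\epsilon>0$. For a subgraph $K$ of $G$ let $\mathsf{dist}_K$ be the shortest path distance in $K$ with respect to $\mathbf w$, and for a set of edges or a path $X$ let $\mathbf w(X)$ be its total weight. Let $G_{\mathsf{opt},\epsilon}$ be a minimum-weight $(1+\epsilon)$-spanner of $G$, that is, a subgraph of minimum total weight among the subgraphs $K$ of $G$ on $V$ with $\mathsf{dist}_K(u,v)\le(1+\epsilon)\,\mathsf{dist}_G(u,v)$ for all $u,v\in V$. Let $H$ be a subgraph of $G$ (for instance, the current spanner) such that $\mathsf{dist}_G(u,v)=\mathbf w(u,v)$ for every edge $(u,v)\in E(H)$, let $F^{\mathrm{new}},F^{\mathrm{old}}$ be sets of edges, and put $$\alpha=\frac{\mathbf w\big(E(H)\setminus(F^{\mathrm{new}}\cup F^{\mathrm{old}})\big)}{\mathbf w(G_{\mathsf{opt},\epsilon})}.$$ An edge $e$ of $H$ is $\kappa$-hanging at $(v_i,v_j)$, where $i<j$, on a path $\rho=\langle v_1,\dots,v_k\rangle$ if $\mathbf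 w(\rho[v_i,v_j])\ge\kappa\,\mathbf w(e)$ and, for a suitable naming $e=(a,b)$ of its ends, $$\mathsf{dist}_G(a,v_i)+\mathbf w(\rho[v_i,v_j])+\mathsf{dist}_G(v_j,b)\le(1+\epsilon)\,\mathbf w(e),$$ where $\rho[v_i,v_j]$ is the subpath of $\rho$ between $v_i$ and $v_j$. Then there exist a shortest path $\rho^*$ in $G_{\mathsf{opt},\epsilon}$ between two distinct vertices, a set $F^*\subseteq E(H)\setminus(F^{\mathrm{new}}\cup F^{\mathrm{old}})$, and for each $e\in F^*$ a pair $(a_e,b_e)$ of vertices of $\rho^*$, such that: 1. each edge $e\in F^*$ is $\frac23$-hanging at $(a_e,b_e)$ on $\rho^*$; 2. $\mathbf w(F^*)\ge\frac{\alpha}{6}\,\mathbf w(\rho^*)$; 3. the subpaths $\{\rho^*[a_e,b_e]:e\in F^*\}$, taken as sets of edges, form a laminar family: any two of them are either disjoint or related by containment. -/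

import Mathlib

open scoped ENNReal

namespace PlanarPruning

/-! ## Planar graphs -/

/-- The subset of the plane covered by the polyline with the given list of corners. -/
def polyline : List (ℝ × ℝ) → Set (ℝ × ℝ)
  | [] => ∅
  | [p] => {p}
  | p :: q :: l => segment ℝ p q ∪ polyline (q :: l)

/-- The polyline with the given list of corners is non-degenerate and does not touch itself,
that is, it is a polygonal arc: each segment meets the rest of the polyline that follows it
only in their common corner. -/
def IsSimplePolyline : List (ℝ × ℝ) → Prop
  | [] => True
  | [_] => True
  | p :: q :: l => p ≠ q ∧ segment ℝ p q ∩ polyline (q :: l) = {q} ∧ IsSimplePolyline (q :: l)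

/-- A plane drawing of a graph: the vertices are distinct points of the plane, each edge `uv` is
a polygonal arc between the points of `u` and `v`, an arc contains no vertices other than its
two ends, and two distinct arcs meet only in common ends. -/
structure PlaneDrawing {V : Type*} (G : SimpleGraph V) where
  point : V → ℝ × ℝ
  arc : Sym2 V → Set (ℝ × ℝ)
  point_injective : Function.Injective point
  arc_polygonal : ∀ u v : V, G.Adj u v → ∃ bends : List (ℝ × ℝ),
    IsSimplePolyline (point u :: (bends ++ [point v])) ∧
      arc s(u, v) = polyline (point u :: (bends ++ [point v]))
  mem_of_point_mem_arc : ∀ e ∈ G.edgeSet, ∀ v : V, point v ∈ arc e → v ∈ e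
  arc_inter_arc : ∀ e ∈ G.edgeSet, ∀ f ∈ G.edgeSet, e ≠ f →
    arc e ∩ arc f ⊆ point '' {v | v ∈ e ∧ v ∈ f}

/-- A graph is planar if it has a plane drawing. -/
def IsPlanar {V : Type*} (G : SimpleGraph V) : Prop :=
  Nonempty (PlaneDrawing G)

/-! ## Weights, distances, spanners -/

/-- The total weight of a set of edges (only used for finite sets). -/
noncomputable def weight {V : Type*} (w : Sym2 V → ℕ) (F : Set (Sym2 V)) : ℕ :=
  ∑ᶠ e ∈ F, w e

/-- The weight of a walk: the sum of the weights of its edges, with multiplicity. -/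
def walkWeight {V : Type*} {G : SimpleGraph V} (w : Sym2 V → ℕ) {u v : V} (p : G.Walk u v) : ℕ :=
  (p.edges.map w).sum

/-- The shortest path distance; it is `∞` between different connected components. -/
noncomputable def wdist {V : Type*} (G : SimpleGraph V) (w : Sym2 V → ℕ) (u v : V) : ℝ≥0∞ :=
  ⨅ p : G.Walk u v, (walkWeight w p : ℝ≥0∞)

/-- `p` is a shortest path in `G`. -/
def IsShortestPath {V : Type*} {G : SimpleGraph V} (w : Sym2 V → ℕ) {u v : V}
    (p : G.Walk u v) : Prop :=
  p.IsPath ∧ (walkWeight w p : ℝ≥0∞) = wdist G w u v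

/-- `H` is a `t`-spanner of `G`. -/
def IsSpanner {V : Type*} (G : SimpleGraph V) (w : Sym2 V → ℕ) (t : ℝ) (H : SimpleGraph V) :
    Prop :=
  H ≤ G ∧ ∀ u v : V, wdist H w u v ≤ ENNReal.ofReal t * wdist G w u v

/-- `H` is a `t`-spanner of `G` of minimum total weight. -/
def IsMinWeightSpanner {V : Type*} (G : SimpleGraph V) (w : Sym2 V → ℕ) (t : ℝ)
    (H : SimpleGraph V) : Prop :=
  IsSpanner G w t H ∧
    ∀ K : SimpleGraph V, IsSpanner G w t K → weight w H.edgeSet ≤ weight w K.edgeSet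

/-! ## Hanging edges, laminar families -/

/-- For `ρ = ⟨v₀, v₁, …, v_k⟩` and `i ≤ j ≤ k`, the subpath `ρ[v_i, v_j]`. -/
def subpath {V : Type*} {K : SimpleGraph V} {x y : V} (ρ : K.Walk x y) (i j : ℕ) :
    K.Walk (ρ.getVert i) ((ρ.drop i).getVert (j - i)) :=
  (ρ.drop i).take (j - i)

/-- The edge `e` of `G` is `κ`-hanging at `(v_i, v_j)` on the walk `ρ = ⟨v₀, v₁, …, v_k⟩`, which
runs in a subgraph `K` of `G`; `e` is undirected, so either end may be the one next to `v_i`. -/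
def IsHangingAt {V : Type*} (G : SimpleGraph V) (w : Sym2 V → ℕ) (ε κ : ℝ) {K : SimpleGraph V}
    {x y : V} (ρ : K.Walk x y) (e : Sym2 V) (i j : ℕ) : Prop :=
  i < j ∧ j ≤ ρ.length ∧
    κ * (w e : ℝ) ≤ (walkWeight w (subpath ρ i j) : ℝ) ∧
    ∃ a b : V, e = s(a, b) ∧
      wdist G w a (ρ.getVert i) + (walkWeight w (subpath ρ i j) : ℝ≥0∞)
          + wdist G w (ρ.getVert j) b
        ≤ ENNReal.ofReal (1 + ε) * (w e : ℝ≥0∞)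

/-- A laminar family: any two members are disjoint or related by containment. -/
def IsLaminar {α : Type*} (𝓕 : Set (Set α)) : Prop :=
  ∀ A ∈ 𝓕, ∀ B ∈ 𝓕, Disjoint A B ∨ A ⊆ B ∨ B ⊆ A

end PlanarPruning

/-!
The edges `e` of `X = E(H) \ (Fnew ∪ Fold)` are spread over the shortest paths that serve them in
the optimal spanner `K`. Break ties between weights so that distinct edge sets have distinct
weights, and let `J e` be the minimum edge set of `K` whose odd vertices are the two ends of `e`. It
is the edge set of a shortest path (`IsMinJoin.exists_isShortestPath`), of weight between `w e` and
`(1 + ε) w e`. An exchange argument shows that `J e ∪ J f` contains no nonempty even edge set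
(`IsMinJoin.eq_empty_of_even`); hence the common edges of two such paths form a subpath of both
(`exists_subpath_edges_eq_inter`).

In a plane drawing, `J e` together with `e` bounds a region `R e`. These regions are laminar: two of
them divide the sides of the edges into four classes, each with an even set of boundary edges; the
boundary of one class contains neither `e` nor `f`, so lies in `J e ∪ J f`, so is empty, and the
class is empty too (`laminar_of_side_labels`). The only topology needed is a parity count: a side of
an edge is labelled by the parity of the number of edges of the cycle above it
(`exists_side_labels` for segments, `IsPlanar.exists_side_labels` for polygonal drawings).

If `R e ⊆ R f`, and at least two thirds of `w e` is on `J e ∩ J f`, then `e` hangs on the path `J f`,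
and the traces `J e ∩ J f` of such regions on `J f` inherit laminarity from the regions
(`IsRegionSystem.inter_laminar`). Going through the regions from the largest to the smallest, keep
those that hang on none kept before. By laminarity, the inner sides of a region that are
inner sides of regions kept before already are inner sides of the smallest of these around it; so a
third of the inner sides of each kept region is new, and the boundaries of the kept regions have at
most three times the total weight of all sides, that is, six times the weight of `K`
(`IsRegionSystem.exists_heads`). As every edge hangs on a kept one, averaging yields the path
(`IsRegionSystem.exists_heavy`).
-/


/-! ### Systems of non-crossing segments -/

namespace PlanarPruning

section Segments

variable {ι : Type*} {l r : ι → ℝ × ℝ}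

/-- The segments from `l i` to `r i` run strictly from left to right, and two distinct segments
meet only in ends of theirs. -/
structure IsSegmentSystem (l r : ι → ℝ × ℝ) : Prop where
  lt : ∀ i, (l i).1 < (r i).1
  meet : ∀ i j, i ≠ j → ∀ z ∈ segment ℝ (l i) (r i), z ∈ segment ℝ (l j) (r j) →
    z = l i ∨ z = r i

/-- The height at abscissa `x` of the line through `l i` and `r i`. -/
noncomputable def height (l r : ι → ℝ × ℝ) (i : ι) (x : ℝ) : ℝ :=
  (l i).2 + (x - (l i).1) * (((r i).2 - (l i).2) / ((r i).1 - (l i).1))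

/-- Segment `j` runs above segment `i` over some common interior abscissa. For a segment system,
this then holds over all of them. -/
def Above (l r : ι → ℝ × ℝ) (j i : ι) : Prop :=
  ∃ x, ((l i).1 < x ∧ x < (r i).1) ∧ ((l j).1 < x ∧ x < (r j).1) ∧
    height l r i x < height l r j x

theorem height_left (i : ι) : height l r i (l i).1 = (l i).2 := by simp [height]

theorem IsSegmentSystem.height_right (h : IsSegmentSystem l r) (i : ι) :
    height l r i (r i).1 = (r i).2 := by
  have := h.lt i
  have : (r i).1 - (l i).1 ≠ 0 := by linarith
  simp only [height]
  field_simp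
  ring

theorem continuous_height (i : ι) : Continuous (height l r i) := by
  unfold height; fun_prop

theorem not_above_self (i : ι) : ¬ Above l r i i := by
  rintro ⟨x, -, -, hx⟩
  exact lt_irrefl _ hx

theorem IsSegmentSystem.mem_segment (h : IsSegmentSystem l r) {i : ι} {x : ℝ}
    (h1 : (l i).1 ≤ x) (h2 : x ≤ (r i).1) :
    (x, height l r i x) ∈ segment ℝ (l i) (r i) := by
  have hlt := h.lt i
  have hne : (r i).1 - (l i).1 ≠ 0 := by linarith
  rw [segment_eq_image']
  refine ⟨(x - (l i).1) / ((r i).1 - (l i).1), ⟨?_, ?_⟩, ?_⟩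
  · exact div_nonneg (by linarith) (by linarith)
  · rw [div_le_one (by linarith)]; linarith
  · ext
    · simp
      field_simp
      ring
    · simp [height]
      field_simp

theorem IsSegmentSystem.height_ne (h : IsSegmentSystem l r) {i j : ι} (hij : i ≠ j) {x : ℝ}
    (hi1 : (l i).1 < x) (hi2 : x < (r i).1) (hj1 : (l j).1 ≤ x) (hj2 : x ≤ (r j).1) :
    height l r i x ≠ height l r j x := by
  intro he
  have h1 := h.mem_segment (i := j) hj1 hj2
  rw [← he] at h1
  rcases h.meet i j hij _ (h.mem_segment hi1.le hi2.le) h1 with h2 | h2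
  · rw [← h2] at hi1; exact lt_irrefl _ hi1
  · rw [← h2] at hi2; exact lt_irrefl _ hi2

/-- Two segments do not change their vertical order: they would have to cross in between. -/
theorem IsSegmentSystem.height_le_of_lt (h : IsSegmentSystem l r) {i j : ι} {x y : ℝ}
    (hix1 : (l i).1 ≤ x) (hix2 : x ≤ (r i).1) (hjx1 : (l j).1 ≤ x) (hjx2 : x ≤ (r j).1)
    (hiy1 : (l i).1 ≤ y) (hiy2 : y ≤ (r i).1) (hjy1 : (l j).1 ≤ y) (hjy2 : y ≤ (r j).1)
    (hx : height l r i x < height l r j x) : height l r i y ≤ height l r j y := by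
  by_contra! hy
  have hij : i ≠ j := by rintro rfl; exact lt_irrefl _ hx
  have hc : ContinuousOn (fun t => height l r i t - height l r j t) (Set.uIcc x y) :=
    ((continuous_height i).sub (continuous_height j)).continuousOn
  have h0 : (0 : ℝ) ∈ Set.uIcc (height l r i x - height l r j x)
      (height l r i y - height l r j y) := by
    rw [Set.mem_uIcc]; left; constructor <;> linarith
  obtain ⟨t, ht, ht0⟩ := intermediate_value_uIcc hc h0
  simp only at ht0
  have hne1 : t ≠ x := by rintro rfl; linarith
  have hne2 : t ≠ y := by rintro rfl; linarith
  have hb : (l i).1 < t ∧ t < (r i).1 ∧ (l j).1 ≤ t ∧ t ≤ (r j).1 := by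
    rw [Set.mem_uIcc] at ht
    rcases ht with ⟨h1, h2⟩ | ⟨h1, h2⟩
    · have h1' := lt_of_le_of_ne h1 hne1.symm
      have h2' := lt_of_le_of_ne h2 hne2
      refine ⟨?_, ?_, ?_, ?_⟩ <;> linarith
    · have h1' := lt_of_le_of_ne h1 hne2.symm
      have h2' := lt_of_le_of_ne h2 hne1
      refine ⟨?_, ?_, ?_, ?_⟩ <;> linarith
  exact h.height_ne hij hb.1 hb.2.1 hb.2.2.1 hb.2.2.2 (by linarith)

theorem IsSegmentSystem.height_le_of_above (h : IsSegmentSystem l r) {i j : ι}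
    (ha : Above l r j i) {y : ℝ}
    (hiy1 : (l i).1 ≤ y) (hiy2 : y ≤ (r i).1) (hjy1 : (l j).1 ≤ y) (hjy2 : y ≤ (r j).1) :
    height l r i y ≤ height l r j y := by
  obtain ⟨x, hi, hj, hx⟩ := ha
  exact h.height_le_of_lt hi.1.le hi.2.le hj.1.le hj.2.le hiy1 hiy2 hjy1 hjy2 hx

theorem IsSegmentSystem.above_of_height_lt (h : IsSegmentSystem l r) {i j : ι} {y : ℝ}
    (hiy1 : (l i).1 ≤ y) (hiy2 : y ≤ (r i).1) (hjy1 : (l j).1 ≤ y) (hjy2 : y ≤ (r j).1)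
    (h1 : (l i).1 < (r j).1) (h2 : (l j).1 < (r i).1)
    (hy : height l r i y < height l r j y) : Above l r j i := by
  have hij : i ≠ j := by rintro rfl; exact lt_irrefl _ hy
  obtain ⟨m, hm1, hm2⟩ : ∃ m, max (l i).1 (l j).1 < m ∧ m < min (r i).1 (r j).1 := by
    apply exists_between
    simp [h.lt, h1, h2]
  simp only [max_lt_iff, lt_min_iff] at hm1 hm2
  refine ⟨m, ⟨hm1.1, hm2.1⟩, ⟨hm1.2, hm2.2⟩, lt_of_le_of_ne ?_ ?_⟩
  · exact h.height_le_of_lt hiy1 hiy2 hjy1 hjy2 hm1.1.le hm2.1.le hm1.2.le hm2.2.le hy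
  · exact h.height_ne hij hm1.1 hm2.1 hm1.2.le hm2.2.le

theorem IsSegmentSystem.above_iff (h : IsSegmentSystem l r) {i j : ι} {x : ℝ}
    (hi1 : (l i).1 < x) (hi2 : x < (r i).1) (hj1 : (l j).1 < x) (hj2 : x < (r j).1) :
    Above l r j i ↔ height l r i x < height l r j x := by
  constructor
  · intro ha
    have hij : i ≠ j := by rintro rfl; exact not_above_self _ ha
    exact lt_of_le_of_ne (h.height_le_of_above ha hi1.le hi2.le hj1.le hj2.le)
      (h.height_ne hij hi1 hi2 hj1.le hj2.le)
  · intro hx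
    exact ⟨x, ⟨hi1, hi2⟩, ⟨hj1, hj2⟩, hx⟩

end Segments

section Count

open scoped Classical in
/-- Crossing the members of `A` one after the other, from the top to the bottom, the jumps of `F`
telescope. -/
theorem sum_jump_telescope {ι M : Type*} [AddCommGroup M] (A : Finset ι) (h : ι → ℝ)
    (hinj : Set.InjOn h A) (c : ι → M) (k : M) (F : M → ZMod 2) :
    ∑ i ∈ A, (F (k + ∑ j ∈ A with h i < h j, c j) +
        F (k + ∑ j ∈ A with h i < h j, c j + c i)) =
      F k + F (k + ∑ j ∈ A, c j) := by
  induction A using Finset.induction_on_min_value h with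
  | empty => simp [CharTwo.add_self_eq_zero]
  | insert a s ha hmin ih =>
    rw [Finset.sum_insert ha]
    have hlt : ∀ x ∈ s, h a < h x := fun x hx =>
      lt_of_le_of_ne (hmin x hx) fun he => ha (by
        rwa [hinj (by simp) (by simp [hx]) he])
    have e1 : {j ∈ insert a s | h a < h j} = s := by
      ext j
      simp only [Finset.mem_filter, Finset.mem_insert]
      constructor
      · rintro ⟨rfl | hj, hj'⟩
        · exact absurd hj' (lt_irrefl _)
        · exact hj
      · exact fun hj => ⟨Or.inr hj, hlt j hj⟩
    have e2 : ∀ i ∈ s, {j ∈ insert a s | h i < h j} = {j ∈ s | h i < h j} := by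
      intro i hi
      rw [Finset.filter_insert, if_neg (not_lt.2 (hmin i hi))]
    have e3 : ∑ i ∈ s, (F (k + ∑ j ∈ insert a s with h i < h j, c j) +
        F (k + ∑ j ∈ insert a s with h i < h j, c j + c i)) = F k + F (k + ∑ j ∈ s, c j) := by
      rw [← ih (hinj.mono (by simp))]
      exact Finset.sum_congr rfl fun i hi => by rw [e2 i hi]
    rw [e1, e3, Finset.sum_insert ha, add_comm (c a)]
    generalize F k = u
    generalize F (k + ∑ j ∈ s, c j) = v
    rw [← add_assoc k]
    generalize F (k + ∑ j ∈ s, c j + c a) = x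
    linear_combination CharTwo.add_self_eq_zero v

open scoped Classical in
/-- The telescoping sum over segments that share an interior abscissa `x`. -/
theorem IsSegmentSystem.sum_jump {ι M : Type*} [AddCommGroup M] {l r : ι → ℝ × ℝ}
    {c : ι → M} (h : IsSegmentSystem l r) (A : Finset ι) (x : ℝ)
    (hx : ∀ i ∈ A, (l i).1 < x ∧ x < (r i).1) (k : M) (F : M → ZMod 2) :
    ∑ i ∈ A, (F (k + ∑ j ∈ A with Above l r j i, c j) +
        F (k + ∑ j ∈ A with Above l r j i, c j + c i)) =
      F k + F (k + ∑ j ∈ A, c j) := by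
  have hinj : Set.InjOn (fun i => height l r i x) A := by
    intro i hi j hj hij
    by_contra hne
    exact h.height_ne hne (hx i hi).1 (hx i hi).2 (hx j hj).1.le (hx j hj).2.le hij
  rw [← sum_jump_telescope A (fun i => height l r i x) hinj c k F]
  refine Finset.sum_congr rfl fun i hi => ?_
  have : {j ∈ A | Above l r j i} = {j ∈ A | height l r i x < height l r j x} :=
    Finset.filter_congr fun j hj =>
      h.above_iff (hx i hi).1 (hx i hi).2 (hx j hj).1 (hx j hj).2
  rw [this]

theorem exists_right_of_forall_lt {ι : Type*} (A : Finset ι) (f : ι → ℝ) (x : ℝ) (h : ∀ i ∈ A, x < f i) :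
    ∃ y, x < y ∧ ∀ i ∈ A, y < f i := by
  have h1 : ∀ᶠ y in nhdsWithin x (Set.Ioi x), ∀ i ∈ A, y < f i :=
    (Filter.eventually_all_finset A).2 fun i hi =>
      nhdsWithin_le_nhds (eventually_lt_nhds (h i hi))
  obtain ⟨y, hy1, hy2⟩ := (h1.and self_mem_nhdsWithin).exists
  exact ⟨y, hy2, hy1⟩

theorem exists_left_of_forall_lt {ι : Type*} (A : Finset ι) (f : ι → ℝ) (x : ℝ) (h : ∀ i ∈ A, f i < x) :
    ∃ y, y < x ∧ ∀ i ∈ A, f i < y := by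
  have h1 : ∀ᶠ y in nhdsWithin x (Set.Iio x), ∀ i ∈ A, f i < y :=
    (Filter.eventually_all_finset A).2 fun i hi =>
      nhdsWithin_le_nhds (eventually_gt_nhds (h i hi))
  obtain ⟨y, hy1, hy2⟩ := (h1.and self_mem_nhdsWithin).exists
  exact ⟨y, hy2, hy1⟩

variable {ι M : Type*} [Fintype ι] [AddCommGroup M] {l r : ι → ℝ × ℝ} {c : ι → M}

open scoped Classical in
/-- If the labels sum to zero at every point, then they do so over any region, where a label counts
once for each end of its segment that is in the region. -/
theorem sum_ends_region (hc : ∀ z, ∑ i, ((if l i = z then c i else 0) +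
      (if r i = z then c i else 0)) = 0) (U : ℝ × ℝ → Prop) :
    ∑ i, ((if U (l i) then c i else 0) + (if U (r i) then c i else 0)) = 0 := by
  have key : ∀ f : ι → ℝ × ℝ, (∀ i, f i ∈ Finset.univ.image l ∪ Finset.univ.image r) → ∀ i,
      (if U (f i) then c i else 0) =
      ∑ z ∈ Finset.univ.image l ∪ Finset.univ.image r,
        if U z then (if f i = z then c i else 0) else 0 := by
    intro f hf i
    rw [Finset.sum_eq_single_of_mem (f i) (hf i)]
    · simp
    · intro b _ hb
      simp [hb.symm]
  have h1 := key l (by simp)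
  have h2 := key r (by simp)
  simp_rw [h1, h2, ← Finset.sum_add_distrib]
  rw [Finset.sum_comm]
  refine Finset.sum_eq_zero fun z _ => ?_
  by_cases hz : U z
  · simpa [hz] using hc z
  · simp [hz]

open scoped Classical in
/-- The sum of the labels of the segments that run above segment `i` just to the right of the
abscissa `x`. -/
noncomputable def sumAbove (l r : ι → ℝ × ℝ) (c : ι → M) (i : ι) (x : ℝ) : M :=
  ∑ j, if ((l j).1 ≤ x ∧ x < (r j).1) ∧ Above l r j i then c j else 0

open scoped Classical in
/-- The sum of the labels above a segment is the same all along it: the labels that end or begin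
over its interior cancel, end by end. -/
theorem IsSegmentSystem.sumAbove_eq (h : IsSegmentSystem l r) (hM : ∀ m : M, m + m = 0)
    (hc : ∀ z, ∑ i, ((if l i = z then c i else 0) + (if r i = z then c i else 0)) = 0)
    {i : ι} {x : ℝ} (h1 : (l i).1 ≤ x) (h2 : x < (r i).1) :
    sumAbove l r c i x =
      ∑ j, if ((l j).1 < (r i).1 ∧ (r i).1 ≤ (r j).1) ∧ Above l r j i then c j else 0 := by
  have hsub : ∀ a b : M, a + b = 0 → a = b := fun a b hab => by
    rw [← add_left_inj b, hab, hM]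
  apply hsub
  rw [sumAbove, ← Finset.sum_add_distrib]
  refine Eq.trans ?_
    (sum_ends_region hc fun z => (x < z.1 ∧ z.1 < (r i).1) ∧ height l r i z.1 < z.2)
  refine Finset.sum_congr rfl fun j _ => ?_
  have hlt := h.lt j
  by_cases ha : Above l r j i
  · have hij : i ≠ j := by rintro rfl; exact not_above_self _ ha
    have e1 : ((x < (l j).1 ∧ (l j).1 < (r i).1) ∧ height l r i (l j).1 < (l j).2) ↔
        (x < (l j).1 ∧ (l j).1 < (r i).1) := by
      refine ⟨And.left, fun hx => ⟨hx, ?_⟩⟩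
      have := h.height_le_of_above ha (y := (l j).1) (by linarith) hx.2.le le_rfl hlt.le
      have hn := h.height_ne hij (x := (l j).1) (by linarith) hx.2 le_rfl hlt.le
      rw [height_left] at this hn
      exact lt_of_le_of_ne this hn
    have e2 : ((x < (r j).1 ∧ (r j).1 < (r i).1) ∧ height l r i (r j).1 < (r j).2) ↔
        (x < (r j).1 ∧ (r j).1 < (r i).1) := by
      refine ⟨And.left, fun hx => ⟨hx, ?_⟩⟩
      have := h.height_le_of_above ha (y := (r j).1) (by linarith) hx.2.le hlt.le le_rfl
      have hn := h.height_ne hij (x := (r j).1) (by linarith) hx.2 hlt.le le_rfl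
      rw [h.height_right] at this hn
      exact lt_of_le_of_ne this hn
    simp only [e1, e2, ha, and_true]
    obtain ⟨y, hy1, hy2, -⟩ := ha
    by_cases c1 : (l j).1 ≤ x
    · by_cases c2 : (r j).1 ≤ x
      · have : ¬ (r i).1 ≤ (r j).1 := by linarith
        simp [c1.not_gt, c2.not_gt, this]
      · by_cases c3 : (r i).1 ≤ (r j).1
        · simp [c1, c1.not_gt, not_le.1 c2, c3, c3.not_gt, hM,
            show (l j).1 < (r i).1 by linarith]
        · simp [c1, c1.not_gt, not_le.1 c2, c3, not_le.1 c3]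
    · have c4 : (l j).1 < (r i).1 := by linarith
      have c5 : x < (r j).1 := by linarith
      by_cases c3 : (r i).1 ≤ (r j).1
      · simp [c1, not_le.1 c1, c3, c3.not_gt, c4]
      · simp [c1, not_le.1 c1, c3, not_le.1 c3, c4, c5, hM]
  · have e1 : ¬ ((x < (l j).1 ∧ (l j).1 < (r i).1) ∧ height l r i (l j).1 < (l j).2) := by
      rintro ⟨hx, hh⟩
      rw [← height_left (l := l) (r := r) j] at hh
      exact ha (h.above_of_height_lt (by linarith) hx.2.le le_rfl hlt.le
        (by linarith) (by linarith) hh)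
    have e2 : ¬ ((x < (r j).1 ∧ (r j).1 < (r i).1) ∧ height l r i (r j).1 < (r j).2) := by
      rintro ⟨hx, hh⟩
      rw [← h.height_right j] at hh
      exact ha (h.above_of_height_lt (by linarith) hx.2.le hlt.le le_rfl
        (by linarith) (by linarith) hh)
    simp only [ha, e1, e2, and_false, if_false]

theorem IsSegmentSystem.sumAbove_eq_sumAbove (h : IsSegmentSystem l r) (hM : ∀ m : M, m + m = 0)
    (hc : ∀ z, ∑ i, ((open scoped Classical in if l i = z then c i else 0) +
      (open scoped Classical in if r i = z then c i else 0)) = 0)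
    {i : ι} {x y : ℝ} (h1 : (l i).1 ≤ x) (h2 : x < (r i).1) (h3 : (l i).1 ≤ y)
    (h4 : y < (r i).1) :
    sumAbove l r c i x = sumAbove l r c i y := by
  rw [h.sumAbove_eq hM hc h1 h2, h.sumAbove_eq hM hc h3 h4]

open scoped Classical in
/-- The sum of the labels of the segments that run above the point `v` just to its right; counted
just to its left, the sum is the same. -/
theorem IsSegmentSystem.sum_above_point (h : IsSegmentSystem l r) (hM : ∀ m : M, m + m = 0)
    (hc : ∀ z, ∑ i, ((if l i = z then c i else 0) + (if r i = z then c i else 0)) = 0)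
    (v : ℝ × ℝ) :
    (∑ j, if ((l j).1 ≤ v.1 ∧ v.1 < (r j).1) ∧ v.2 < height l r j v.1 then c j else 0) =
      ∑ j, if ((l j).1 < v.1 ∧ v.1 ≤ (r j).1) ∧ v.2 < height l r j v.1 then c j else 0 := by
  have hsub : ∀ a b : M, a + b = 0 → a = b := fun a b hab => by
    rw [← add_left_inj b, hab, hM]
  apply hsub
  rw [← Finset.sum_add_distrib]
  refine Eq.trans ?_ (sum_ends_region hc fun z => z.1 = v.1 ∧ v.2 < z.2)
  refine Finset.sum_congr rfl fun j _ => ?_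
  have hlt := h.lt j
  have e1 : ((l j).1 = v.1 ∧ v.2 < (l j).2) ↔ ((l j).1 = v.1 ∧ v.2 < height l r j v.1) := by
    refine and_congr_right fun he => ?_
    rw [← he, height_left]
  have e2 : ((r j).1 = v.1 ∧ v.2 < (r j).2) ↔ ((r j).1 = v.1 ∧ v.2 < height l r j v.1) := by
    refine and_congr_right fun he => ?_
    rw [← he, h.height_right]
  simp only [e1, e2]
  by_cases hv : v.2 < height l r j v.1
  · simp only [hv, and_true]
    rcases lt_trichotomy (l j).1 v.1 with h1 | h1 | h1
    · rcases lt_trichotomy (r j).1 v.1 with h2 | h2 | h2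
      · simp [h1.ne, h2.ne, h2.not_gt, h2.not_ge]
      · simp [h1.ne, h2, h1]
      · simp [h1.ne, h2.ne', h1, h2.le, h1.le, h2, hM]
    · have h2 : v.1 < (r j).1 := by linarith
      simp [h1, h2, h2.ne']
    · have h2 : v.1 < (r j).1 := by linarith
      simp [h1.ne', h2.ne', h1.not_gt, h1.not_ge]
  · simp [hv]

open scoped Classical in
/-- The sum above a segment, split at its left end `l i` into the segments that pass above this point
and those that start at it. -/
theorem IsSegmentSystem.sumAbove_left (h : IsSegmentSystem l r) (i : ι) :
    sumAbove l r c i (l i).1 =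
      (∑ j, if ((l j).1 ≤ (l i).1 ∧ (l i).1 < (r j).1) ∧ (l i).2 < height l r j (l i).1
        then c j else 0) + ∑ j with l j = l i ∧ Above l r j i, c j := by
  rw [sumAbove, Finset.sum_filter, ← Finset.sum_add_distrib]
  refine Finset.sum_congr rfl fun j _ => ?_
  have hi := h.lt i
  have hj := h.lt j
  by_cases hl : l j = l i
  · have hh : height l r j (l i).1 = (l i).2 := by rw [← hl, height_left]
    have : (l i).1 < (r j).1 := by rwa [← hl]
    simp [hl, hh, this]
  · simp only [hl, false_and, if_false, add_zero]
    refine if_congr (and_congr_right fun hx => ?_) rfl rfl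
    rw [← height_left (l := l) (r := r) i]
    constructor
    · intro ha
      refine lt_of_le_of_ne (h.height_le_of_above ha le_rfl hi.le hx.1 hx.2.le) fun he => ?_
      rcases hx.1.lt_or_eq with h1 | h1
      · exact h.height_ne (fun e => hl (by rw [e])) h1 hx.2 le_rfl hi.le he.symm
      · apply hl
        ext
        · exact h1
        · rw [height_left, ← h1, height_left] at he
          exact he.symm
    · intro hh
      exact h.above_of_height_lt le_rfl hi.le hx.1 hx.2.le hx.2 (by linarith) hh

open scoped Classical in
/-- The sum above a segment, split at its right end `r i` into the segments that pass above this point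
and those that end at it. -/
theorem IsSegmentSystem.sumAbove_right (h : IsSegmentSystem l r) (hM : ∀ m : M, m + m = 0)
    (hc : ∀ z, ∑ i, ((if l i = z then c i else 0) + (if r i = z then c i else 0)) = 0) (i : ι) :
    sumAbove l r c i (l i).1 =
      (∑ j, if ((l j).1 < (r i).1 ∧ (r i).1 ≤ (r j).1) ∧ (r i).2 < height l r j (r i).1
        then c j else 0) + ∑ j with r j = r i ∧ Above l r j i, c j := by
  rw [h.sumAbove_eq hM hc le_rfl (h.lt i), Finset.sum_filter, ← Finset.sum_add_distrib]
  refine Finset.sum_congr rfl fun j _ => ?_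
  have hi := h.lt i
  have hj := h.lt j
  by_cases hl : r j = r i
  · have hh : height l r j (r i).1 = (r i).2 := by rw [← hl, h.height_right]
    have : (l j).1 < (r i).1 := by rwa [← hl]
    simp [hl, hh, this]
  · simp only [hl, false_and, if_false, add_zero]
    refine if_congr (and_congr_right fun hx => ?_) rfl rfl
    rw [← h.height_right i]
    constructor
    · intro ha
      refine lt_of_le_of_ne (h.height_le_of_above ha hi.le le_rfl hx.1.le hx.2) fun he => ?_
      rcases hx.2.lt_or_eq with h1 | h1
      · exact h.height_ne (fun e => hl (by rw [e])) hx.1 h1 hi.le le_rfl he.symm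
      · apply hl
        ext
        · exact h1.symm
        · rw [h.height_right, h1, h.height_right] at he
          exact he.symm
    · intro hh
      exact h.above_of_height_lt hi.le le_rfl hx.1.le hx.2 (by linarith) hx.1 hh

open scoped Classical in
/-- Around a point, the jumps of `F` at the segments that end there cancel: they telescope over the
segments to the right of the point and over those to the left of it, between the same two
values. -/
theorem IsSegmentSystem.sum_jump_point (h : IsSegmentSystem l r) (hM : ∀ m : M, m + m = 0)
    (hc : ∀ z, ∑ i, ((if l i = z then c i else 0) + (if r i = z then c i else 0)) = 0)
    (F : M → ZMod 2) (v : ℝ × ℝ) (δ : ι → ZMod 2)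
    (hδ : ∀ i, δ i = F (sumAbove l r c i (l i).1) + F (sumAbove l r c i (l i).1 + c i)) :
    ∑ i, ((if l i = v then δ i else 0) + (if r i = v then δ i else 0)) = 0 := by
  set k := ∑ j, if ((l j).1 ≤ v.1 ∧ v.1 < (r j).1) ∧ v.2 < height l r j v.1 then c j else 0
    with hk
  have hR : ∑ i with l i = v, δ i = F k + F (k + ∑ i with l i = v, c i) := by
    obtain ⟨x, hx1, hx2⟩ := exists_right_of_forall_lt (Finset.univ.filter fun i => l i = v)
      (fun i => (r i).1) v.1 (by
        intro i hi
        rw [← (Finset.mem_filter.1 hi).2]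
        exact h.lt i)
    rw [← h.sum_jump _ x (fun i hi => ⟨by rwa [(Finset.mem_filter.1 hi).2], hx2 i hi⟩)]
    refine Finset.sum_congr rfl fun i hi => ?_
    have hi := (Finset.mem_filter.1 hi).2
    rw [hδ, h.sumAbove_left, Finset.filter_filter]
    simp only [hi, ← hk, add_assoc]
  have hL : ∑ i with r i = v, δ i = F k + F (k + ∑ i with r i = v, c i) := by
    obtain ⟨x, hx1, hx2⟩ := exists_left_of_forall_lt (Finset.univ.filter fun i => r i = v)
      (fun i => (l i).1) v.1 (by
        intro i hi
        rw [← (Finset.mem_filter.1 hi).2]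
        exact h.lt i)
    rw [← h.sum_jump _ x (fun i hi => ⟨hx2 i hi, by rwa [(Finset.mem_filter.1 hi).2]⟩)]
    refine Finset.sum_congr rfl fun i hi => ?_
    have hi := (Finset.mem_filter.1 hi).2
    rw [hδ, h.sumAbove_right hM hc, Finset.filter_filter]
    simp only [hi, hk, h.sum_above_point hM hc v, add_assoc]
  have hLR : ∑ i with l i = v, c i = ∑ i with r i = v, c i := by
    have := hc v
    rw [Finset.sum_add_distrib, ← Finset.sum_filter, ← Finset.sum_filter] at this
    rw [← add_left_inj (∑ i with r i = v, c i), this, hM]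
  rw [Finset.sum_add_distrib, ← Finset.sum_filter, ← Finset.sum_filter, hR, hL, hLR]
  exact CharTwo.add_self_eq_zero _

/-- A function of the sums above that jumps at no segment is constant: going up from a segment,
one reaches the unbounded face. -/
theorem IsSegmentSystem.eq_of_no_jump (h : IsSegmentSystem l r) (hM : ∀ m : M, m + m = 0)
    (hc : ∀ z, ∑ i, ((open scoped Classical in if l i = z then c i else 0) +
      (open scoped Classical in if r i = z then c i else 0)) = 0)
    (F : M → ZMod 2)
    (hF : ∀ i, F (sumAbove l r c i (l i).1) = F (sumAbove l r c i (l i).1 + c i)) (i : ι) :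
    F (sumAbove l r c i (l i).1) = F 0 := by
  classical
  set A : Finset ι := {j | ((l j).1 ≤ (l i).1 ∧ (l i).1 < (r j).1) ∧ Above l r j i} with hA
  have hmem : ∀ j, j ∈ A ↔ ((l j).1 ≤ (l i).1 ∧ (l i).1 < (r j).1) ∧ Above l r j i := by
    simp [hA]
  obtain ⟨x, hx1, hx2⟩ := exists_right_of_forall_lt (insert i A) (fun i => (r i).1) (l i).1 (by
    intro j hj
    rcases Finset.mem_insert.1 hj with rfl | hj
    · exact h.lt j
    · exact ((hmem j).1 hj).1.2)
  have hx : ∀ j ∈ A, (l j).1 < x ∧ x < (r j).1 := fun j hj =>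
    ⟨((hmem j).1 hj).1.1.trans_lt hx1, hx2 j (Finset.mem_insert_of_mem hj)⟩
  have key := h.sum_jump (c := c) A x hx 0 F
  have hzero : ∑ j ∈ A, (F (0 + ∑ k ∈ A with Above l r k j, c k) +
      F (0 + ∑ k ∈ A with Above l r k j, c k + c j)) = 0 := by
    refine Finset.sum_eq_zero fun j hj => ?_
    have e : ∑ k ∈ A with Above l r k j, c k = sumAbove l r c j (l j).1 := by
      rw [h.sumAbove_eq_sumAbove hM hc le_rfl (h.lt j) ((hmem j).1 hj).1.1
        ((hmem j).1 hj).1.2, sumAbove, ← Finset.sum_filter]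
      refine Finset.sum_congr ?_ fun _ _ => rfl
      ext k
      simp only [Finset.mem_filter, hmem, Finset.mem_univ, true_and]
      constructor
      · exact fun hk => ⟨hk.1.1, hk.2⟩
      · rintro ⟨hk1, hk2⟩
        refine ⟨⟨hk1, ?_⟩, hk2⟩
        -- a common abscissa, just to the right, makes the relation transitive
        obtain ⟨y, hy1, hy2⟩ := exists_right_of_forall_lt {i, j, k} (fun i => (r i).1) (l i).1 (by
          simp only [Finset.mem_insert, Finset.mem_singleton]
          rintro a (rfl | rfl | rfl)
          · exact h.lt a
          · exact ((hmem a).1 hj).1.2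
          · exact hk1.2)
        have yi := hy2 i (by simp)
        have yj := hy2 j (by simp)
        have yk := hy2 k (by simp)
        have lj := ((hmem j).1 hj).1.1.trans_lt hy1
        have lk := hk1.1.trans_lt hy1
        rw [h.above_iff hy1 yi lk yk]
        exact ((h.above_iff hy1 yi lj yj).1 ((hmem j).1 hj).2).trans
          ((h.above_iff lj yj lk yk).1 hk2)
    rw [e, zero_add, ← hF j]
    exact CharTwo.add_self_eq_zero _
  have hup : ∑ j ∈ A, c j = sumAbove l r c i (l i).1 := by
    rw [sumAbove, ← Finset.sum_filter]
  rw [hzero, hup, zero_add] at key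
  exact (CharTwo.add_eq_zero.1 key.symm).symm

end Count

open scoped Classical in
/-- Labels of the sides of non-crossing segments. If the labels `c` of the segments sum to zero at
every point, each of them is the difference of two labels of its sides, in such a way that the
jumps of a function of the side labels again sum to zero at every point, and that such a function
is constant if it never jumps. The label of a side is the sum of the labels of the segments above
it. The abscissa is sheared to make sure that no segment is vertical. -/
theorem exists_side_labels {ι M : Type*} [Fintype ι] [AddCommGroup M] (hM : ∀ m : M, m + m = 0)
    (a b : ι → ℝ × ℝ) (hab : ∀ i, a i ≠ b i)
    (hmeet : ∀ i j, i ≠ j → ∀ z ∈ segment ℝ (a i) (b i), z ∈ segment ℝ (a j) (b j) →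
      z = a i ∨ z = b i)
    (c : ι → M)
    (hc : ∀ z, ∑ i, ((if a i = z then c i else 0) + (if b i = z then c i else 0)) = 0) :
    ∃ p : ι → Bool → M, (∀ i, p i true + p i false = c i) ∧
      (∀ (F : M → ZMod 2) (z : ℝ × ℝ),
        ∑ i, ((if a i = z then F (p i true) + F (p i false) else 0) +
          (if b i = z then F (p i true) + F (p i false) else 0)) = 0) ∧
      (∀ F : M → ZMod 2, (∀ i, F (p i true) = F (p i false)) → ∀ i s, F (p i s) = F 0) := by
  obtain ⟨t, ht⟩ : ∃ t : ℝ, ∀ i, (a i).1 + t * (a i).2 ≠ (b i).1 + t * (b i).2 := by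
    have hfin : (Set.range fun i => ((b i).1 - (a i).1) / ((a i).2 - (b i).2)).Finite :=
      Set.finite_range _
    obtain ⟨t, ht⟩ := hfin.exists_notMem
    refine ⟨t, fun i hi => ?_⟩
    by_cases h2 : (a i).2 = (b i).2
    · refine hab i (Prod.ext ?_ h2)
      rw [h2] at hi
      linarith
    · refine ht ⟨i, ?_⟩
      have : (a i).2 - (b i).2 ≠ 0 := sub_ne_zero.2 h2
      simp only
      rw [div_eq_iff this]
      linarith
  let T : ℝ × ℝ →ₗ[ℝ] ℝ × ℝ :=
    (LinearMap.fst ℝ ℝ ℝ + t • LinearMap.snd ℝ ℝ ℝ).prod (LinearMap.snd ℝ ℝ ℝ)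
  have hT1 : ∀ z, (T z).1 = z.1 + t * z.2 := fun z => by simp [T]
  have hT2 : ∀ z, (T z).2 = z.2 := fun z => by simp [T]
  have hTinj : Function.Injective T := by
    intro y z hyz
    have h2 : y.2 = z.2 := by rw [← hT2 y, ← hT2 z, hyz]
    have h1 : y.1 + t * y.2 = z.1 + t * z.2 := by rw [← hT1 y, ← hT1 z, hyz]
    rw [h2] at h1
    exact Prod.ext (by linarith) h2
  have hTsurj : Function.Surjective T := LinearMap.injective_iff_surjective.1 hTinj
  have hTseg : ∀ x y z, T z ∈ segment ℝ (T x) (T y) ↔ z ∈ segment ℝ x y := by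
    intro x y z
    have := image_segment ℝ (T.toAffineMap) x y
    simp only [LinearMap.coe_toAffineMap] at this
    rw [← this, hTinj.mem_set_image]
  let q : ι → Prop := fun i => (T (a i)).1 < (T (b i)).1
  let l : ι → ℝ × ℝ := fun i => if q i then T (a i) else T (b i)
  let r : ι → ℝ × ℝ := fun i => if q i then T (b i) else T (a i)
  have hlr : ∀ i z, ((l i = T z ↔ a i = z) ∧ (r i = T z ↔ b i = z)) ∨
      ((l i = T z ↔ b i = z) ∧ (r i = T z ↔ a i = z)) := by
    intro i z
    by_cases hq : q i
    · simp [l, r, hq, hTinj.eq_iff]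
    · simp [l, r, hq, hTinj.eq_iff]
  have hseg : ∀ i, segment ℝ (l i) (r i) = segment ℝ (T (a i)) (T (b i)) := by
    intro i
    by_cases hq : q i
    · simp [l, r, hq]
    · simp [l, r, hq, segment_symm]
  have h : IsSegmentSystem l r := by
    constructor
    · intro i
      by_cases hq : q i
      · simp only [l, r, hq, if_true]
        exact hq
      · have : (T (b i)).1 < (T (a i)).1 :=
          lt_of_le_of_ne (not_lt.1 hq) (by rw [hT1, hT1]; exact (ht i).symm)
        simpa [l, r, hq] using this
    · intro i j hij z hi hj
      obtain ⟨z, rfl⟩ := hTsurj z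
      rw [hseg, hTseg] at hi hj
      have := hmeet i j hij z hi hj
      by_cases hq : q i
      · simpa [l, r, hq, hTinj.eq_iff] using this
      · simpa [l, r, hq, hTinj.eq_iff, or_comm] using this
  have hc' : ∀ z, ∑ i, ((if l i = z then c i else 0) + (if r i = z then c i else 0)) = 0 := by
    intro z
    obtain ⟨z, rfl⟩ := hTsurj z
    refine Eq.trans ?_ (hc z)
    refine Finset.sum_congr rfl fun i _ => ?_
    rcases hlr i z with ⟨h1, h2⟩ | ⟨h1, h2⟩
    · simp only [h1, h2]
    · simp only [h1, h2]
      exact add_comm _ _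
  let u : ι → M := fun i => sumAbove l r c i (l i).1
  refine ⟨fun i s => if s then u i else u i + c i, fun i => ?_, fun F z => ?_, fun F hF => ?_⟩
  · simp only [if_true, Bool.false_eq_true, if_false]
    rw [← add_assoc, hM, zero_add]
  · refine Eq.trans ?_ (h.sum_jump_point hM hc' F (T z)
      (fun i => F (u i) + F (u i + c i)) fun i => rfl)
    refine Finset.sum_congr rfl fun i _ => ?_
    rcases hlr i z with ⟨h1, h2⟩ | ⟨h1, h2⟩
    · simp only [h1, h2, if_true, Bool.false_eq_true, if_false]
    · simp only [h1, h2, if_true, Bool.false_eq_true, if_false]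
      exact add_comm _ _
  · have hF' : ∀ i, F (u i) = F (u i + c i) := fun i => by simpa using hF i
    intro i s
    have := h.eq_of_no_jump hM hc' F hF' i
    cases s
    · simpa [← hF' i] using this
    · simpa using this

end PlanarPruning

/-! ### Side labels of the edges of a planar graph -/

namespace PlanarPruning

theorem IsSimplePolyline.inter_drop {L : List (ℝ × ℝ)} (h : IsSimplePolyline L) {j : ℕ}
    (hj : j + 1 < L.length) :
    L.getD j 0 ≠ L.getD (j + 1) 0 ∧
      segment ℝ (L.getD j 0) (L.getD (j + 1) 0) ∩ polyline (L.drop (j + 1)) =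
        {L.getD (j + 1) 0} := by
  induction L generalizing j with
  | nil => simp at hj
  | cons p L ih =>
    cases L with
    | nil => simp at hj
    | cons q l =>
      cases j with
      | zero => exact ⟨h.1, h.2.1⟩
      | succ j => exact ih h.2.2 (by simpa using hj)

theorem segment_subset_polyline {L : List (ℝ × ℝ)} {k : ℕ} (hk : k + 1 < L.length) :
    segment ℝ (L.getD k 0) (L.getD (k + 1) 0) ⊆ polyline L := by
  induction L generalizing k with
  | nil => simp at hk
  | cons p L ih =>
    cases L with
    | nil => simp at hk
    | cons q l =>
      cases k with
      | zero => exact Set.subset_union_left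
      | succ k =>
        exact (ih (k := k) (by simpa using hk)).trans Set.subset_union_right

/-- Two segments of a simple polyline meet only if they are consecutive, in the corner between
them. -/
theorem IsSimplePolyline.eq_of_mem_of_mem {L : List (ℝ × ℝ)} (h : IsSimplePolyline L) {j k : ℕ}
    (hjk : j < k) (hk : k + 1 < L.length) {z : ℝ × ℝ}
    (hzj : z ∈ segment ℝ (L.getD j 0) (L.getD (j + 1) 0))
    (hzk : z ∈ segment ℝ (L.getD k 0) (L.getD (k + 1) 0)) :
    k = j + 1 ∧ z = L.getD (j + 1) 0 := by
  have key : ∀ i, i < k → z ∈ segment ℝ (L.getD i 0) (L.getD (i + 1) 0) →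
      z = L.getD (i + 1) 0 := by
    intro i hi hz
    have h1 := (h.inter_drop (j := i) (by omega)).2
    have h2 : z ∈ polyline (L.drop (i + 1)) := by
      apply segment_subset_polyline (k := k - (i + 1))
      · simp only [List.length_drop]; omega
      · simp only [List.getD_eq_getElem?_getD, List.getElem?_drop] at hzk ⊢
        rwa [show i + 1 + (k - (i + 1)) = k by omega,
          show i + 1 + (k - (i + 1) + 1) = k + 1 by omega]
    have h3 : z ∈ ({L.getD (i + 1) 0} : Set (ℝ × ℝ)) := h1 ▸ ⟨hz, h2⟩
    exact h3
  have hz := key j hjk hzj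
  refine ⟨?_, hz⟩
  by_contra hne
  have h2 := key (j + 1) (by omega) (hz ▸ left_mem_segment ℝ _ _)
  exact (h.inter_drop (j := j + 1) (by omega)).1 (hz.symm.trans h2)

theorem IsSimplePolyline.eq_of_corner_mem {L : List (ℝ × ℝ)} (h : IsSimplePolyline L) {j k : ℕ}
    (hj : j < L.length) (hk : k + 1 < L.length)
    (hz : L.getD j 0 ∈ segment ℝ (L.getD k 0) (L.getD (k + 1) 0)) : j = k ∨ j = k + 1 := by
  rcases lt_trichotomy j k with h1 | h1 | h1
  · have := h.eq_of_mem_of_mem h1 hk (left_mem_segment ℝ _ _) hz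
    exact absurd this.2 (h.inter_drop (by omega)).1
  · exact Or.inl h1
  · by_contra! hne
    obtain ⟨i, rfl⟩ : ∃ i, j = i + 1 := ⟨j - 1, by omega⟩
    obtain ⟨h2, h3⟩ := h.eq_of_mem_of_mem (j := k) (k := i) (by omega) (by omega) hz
      (right_mem_segment ℝ _ _)
    rw [← h2] at h3
    exact (h.inter_drop (j := i) (by omega)).1 h3.symm

theorem IsSimplePolyline.corner_inj {L : List (ℝ × ℝ)} (h : IsSimplePolyline L) {j k : ℕ}
    (hj : j < L.length) (hk : k < L.length) (hjk : L.getD j 0 = L.getD k 0) : j = k := by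
  wlog hlt : j ≤ k generalizing j k
  · exact (this hk hj hjk.symm (by omega)).symm
  by_contra hne
  have h1 := h.eq_of_corner_mem (j := k) (k := j) hk (by omega)
    (hjk ▸ left_mem_segment ℝ _ _)
  have h2 : k = j + 1 := by omega
  subst h2
  exact (h.inter_drop (by omega)).1 hjk

/-- Modulo 2, the inner corners of a polyline do not count: each is an end of two segments. -/
theorem sum_ends_polyline {N : Type*} [AddCommGroup N] (hN : ∀ m : N, m + m = 0)
    (P : ℕ → Prop) [DecidablePred P] (d : N) (n : ℕ) :
    ∑ k ∈ Finset.range n, ((if P k then d else 0) + (if P (k + 1) then d else 0)) =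
      (if P 0 then d else 0) + (if P n then d else 0) := by
  induction n with
  | zero => by_cases h : P 0 <;> simp [h, hN]
  | succ n ih =>
    rw [Finset.sum_range_succ, ih]
    by_cases h : P n
    · simp only [h, if_true]
      rw [add_assoc, ← add_assoc d d, hN, zero_add]
    · simp [h]

open scoped Classical in
theorem sum_ends_polylines {E N : Type*} [Fintype E] [AddCommGroup N] (hN : ∀ m : N, m + m = 0)
    (n : E → ℕ) (K : E → ℕ → ℝ × ℝ) (d : E → N) (z : ℝ × ℝ) :
    ∑ i : (Σ g : E, Fin (n g)), ((if K i.1 i.2 = z then d i.1 else 0) +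
        (if K i.1 (i.2 + 1) = z then d i.1 else 0)) =
      ∑ g, ((if K g 0 = z then d g else 0) + (if K g (n g) = z then d g else 0)) := by
  rw [Fintype.sum_sigma]
  refine Finset.sum_congr rfl fun g _ => ?_
  have := sum_ends_polyline hN (fun k => K g k = z) (d g) (n g)
  rw [← Fin.sum_univ_eq_sum_range (fun k => (if K g k = z then d g else 0) +
    (if K g (k + 1) = z then d g else 0))] at this
  exact this

theorem ite_eq_add_ite {N : Type*} [AddCommGroup N] {P Q R : Prop} [Decidable P] [Decidable Q]
    [Decidable R] (h : P ↔ Q ∨ R) (hQR : Q → ¬ R) (d : N) :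
    (if P then d else 0) = (if Q then d else 0) + (if R then d else 0) := by
  by_cases hQ : Q
  · simp [h, hQ, hQR hQ]
  · simp [h, hQ]

open scoped Classical in
/-- Side labels for the edges of a planar graph: if the labels `c` of the edges sum to zero at
every vertex, each of them is the difference of the labels of the two sides of the edge, in such a
way that the jumps of a function of the side labels again sum to zero at every vertex, and that
such a function is constant if it never jumps. -/
theorem IsPlanar.exists_side_labels {V M : Type*} [Fintype V] [AddCommGroup M]
    (hM : ∀ m : M, m + m = 0) {G : SimpleGraph V} (hG : IsPlanar G) (E : Finset (Sym2 V))
    (hE : ∀ g, g ∈ E ↔ g ∈ G.edgeSet) (c : Sym2 V → M)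
    (hc : ∀ v, ∑ g ∈ E with v ∈ g, c g = 0) :
    ∃ p : Sym2 V → Bool → M, (∀ g ∈ E, p g true + p g false = c g) ∧
      (∀ (F : M → ZMod 2) (v : V), ∑ g ∈ E with v ∈ g, (F (p g true) + F (p g false)) = 0) ∧
      (∀ F : M → ZMod 2, (∀ g ∈ E, F (p g true) = F (p g false)) →
        ∀ g ∈ E, ∀ s, F (p g s) = F 0) := by
  obtain ⟨D⟩ := hG
  have hL : ∀ g : E, ∃ (L : List (ℝ × ℝ)) (n : ℕ) (u v : V), IsSimplePolyline L ∧
      L.length = n + 1 ∧ 0 < n ∧ g.1 = s(u, v) ∧ u ≠ v ∧ L.getD 0 0 = D.point u ∧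
      L.getD n 0 = D.point v ∧ D.arc g.1 = polyline L := by
    rintro ⟨g, hg⟩
    rw [hE] at hg
    induction g using Sym2.ind with
    | _ u v =>
      obtain ⟨bends, h1, h2⟩ := D.arc_polygonal u v hg
      refine ⟨_, bends.length + 1, u, v, h1, by simp, by simp, rfl, G.ne_of_adj hg, by simp, ?_, h2⟩
      simp
  choose L n u v hsimple hlen hpos hg huv hL0 hLn harc using hL
  have hseg : ∀ (g : E) (k : ℕ), k < n g →
      segment ℝ ((L g).getD k 0) ((L g).getD (k + 1) 0) ⊆ D.arc g.1 := by
    intro g k hk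
    rw [harc]
    exact segment_subset_polyline (by rw [hlen]; omega)
  -- Arcs of distinct edges meet only in first and last corners.
  have hend : ∀ (g g' : E), g ≠ g' → ∀ z ∈ D.arc g.1, z ∈ D.arc g'.1 →
      z = (L g).getD 0 0 ∨ z = (L g).getD (n g) 0 := by
    intro g g' hgg z hz hz'
    obtain ⟨x, ⟨hx, -⟩, rfl⟩ := D.arc_inter_arc g.1 ((hE _).1 g.2) g'.1 ((hE _).1 g'.2)
      (fun h => hgg (Subtype.ext h)) ⟨hz, hz'⟩
    rw [hg g, Sym2.mem_iff] at hx
    rw [hL0, hLn]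
    rcases hx with rfl | rfl <;> simp
  let a : (Σ g : E, Fin (n g)) → ℝ × ℝ := fun i => (L i.1).getD i.2 0
  let b : (Σ g : E, Fin (n g)) → ℝ × ℝ := fun i => (L i.1).getD (i.2 + 1) 0
  have hab : ∀ i, a i ≠ b i := fun i =>
    ((hsimple i.1).inter_drop (by rw [hlen]; have := i.2.2; omega)).1
  have hmeet : ∀ i j, i ≠ j → ∀ z ∈ segment ℝ (a i) (b i), z ∈ segment ℝ (a j) (b j) →
      z = a i ∨ z = b i := by
    rintro ⟨g, j, hj⟩ ⟨g', k, hk⟩ hne z hz hz'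
    simp only [a, b] at hz hz' ⊢
    by_cases hgg : g = g'
    · subst hgg
      have hjk : j ≠ k := by rintro rfl; exact hne rfl
      rcases lt_or_gt_of_ne hjk with h | h
      · exact Or.inr ((hsimple g).eq_of_mem_of_mem h (by rw [hlen]; omega) hz hz').2
      · obtain ⟨h1, h2⟩ := (hsimple g).eq_of_mem_of_mem h (by rw [hlen]; omega) hz' hz
        subst h1
        exact Or.inl h2
    · rcases hend g g' hgg z (hseg g j hj hz) (hseg g' k hk hz') with rfl | rfl
      · rcases (hsimple g).eq_of_corner_mem (by rw [hlen]; omega) (by rw [hlen]; omega) hz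
          with h | h <;> simp [← h]
      · rcases (hsimple g).eq_of_corner_mem (by rw [hlen]; omega) (by rw [hlen]; omega) hz
          with h | h <;> simp [← h]
  have hpt : ∀ {g : E} {x : V}, x ∈ g.1 ↔ (L g).getD 0 0 = D.point x ∨
      (L g).getD (n g) 0 = D.point x := by
    intro g x
    rw [hL0, hLn, hg, Sym2.mem_iff, D.point_injective.eq_iff, D.point_injective.eq_iff,
      eq_comm, eq_comm (a := x)]
  have hnotboth : ∀ g z, (L g).getD 0 0 = z → (L g).getD (n g) 0 ≠ z := by
    rintro g z rfl h
    rw [hL0, hLn] at h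
    exact huv g (D.point_injective h).symm
  have hc' : ∀ z, ∑ i, ((if a i = z then c i.1.1 else 0) +
      (if b i = z then c i.1.1 else 0)) = 0 := by
    intro z
    rw [sum_ends_polylines hM n (fun g k => (L g).getD k 0)
      (fun g => c g.1)]
    by_cases hz : ∃ x, D.point x = z
    · obtain ⟨x, rfl⟩ := hz
      refine Eq.trans ?_ (hc x)
      rw [Finset.sum_filter, ← Finset.sum_coe_sort E]
      exact Finset.sum_congr rfl fun g _ => (ite_eq_add_ite hpt (hnotboth g _) _).symm
    · refine Finset.sum_eq_zero fun g _ => ?_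
      rw [if_neg, if_neg, add_zero]
      · rw [hLn]; exact fun h => hz ⟨_, h⟩
      · rw [hL0]; exact fun h => hz ⟨_, h⟩
  obtain ⟨q, hq1, hq2, hq3⟩ := PlanarPruning.exists_side_labels hM a b hab hmeet (fun i => c i.1.1) hc'
  -- At a bend, the jumps at the two segments of the arc agree.
  have hstep : ∀ (F : M → ZMod 2) (g : E) (k : ℕ) (hk : k < n g),
      F (q ⟨g, k, hk⟩ true) + F (q ⟨g, k, hk⟩ false) =
        F (q ⟨g, 0, hpos g⟩ true) + F (q ⟨g, 0, hpos g⟩ false) := by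
    intro F g k
    induction k with
    | zero => intro _; rfl
    | succ k ih =>
      intro hk
      rw [← ih (by omega)]
      have h1 := hq2 F ((L g).getD (k + 1) 0)
      have hcorner : ∀ (i : Σ g : E, Fin (n g)) (m : ℕ), m = i.2 ∨ m = i.2 + 1 →
          (L i.1).getD m 0 = (L g).getD (k + 1) 0 → i.1 = g ∧ m = k + 1 := by
        rintro ⟨g', j, hj⟩ m hm hz
        simp only at hm hz ⊢
        have hgg : g' = g := by
          by_contra hne
          have h2 : (L g).getD (k + 1) 0 ∈ D.arc g'.1 := by
            apply hseg g' j hj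
            rw [← hz]
            rcases hm with rfl | rfl
            · exact left_mem_segment ℝ _ _
            · exact right_mem_segment ℝ _ _
          have h3 := hseg g (k + 1) hk (left_mem_segment ℝ _ _)
          rcases hend g g' (Ne.symm hne) _ h3 h2 with h | h
          · have := (hsimple g).corner_inj (by rw [hlen]; omega) (by rw [hlen]; omega) h
            omega
          · have := (hsimple g).corner_inj (by rw [hlen]; omega) (by rw [hlen]; omega) h
            omega
        subst hgg
        exact ⟨rfl, (hsimple g').corner_inj (by rw [hlen]; omega) (by rw [hlen]; omega) hz⟩
      have ha : ∀ i, a i = (L g).getD (k + 1) 0 ↔ i = ⟨g, k + 1, hk⟩ := by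
        intro i
        constructor
        · intro h
          obtain ⟨h2, h3⟩ := hcorner i i.2 (Or.inl rfl) h
          obtain ⟨g', j, hj⟩ := i
          simp only at h2 h3
          subst h2 h3
          rfl
        · rintro rfl; rfl
      have hb : ∀ i, b i = (L g).getD (k + 1) 0 ↔ i = ⟨g, k, by omega⟩ := by
        intro i
        constructor
        · intro h
          obtain ⟨h2, h3⟩ := hcorner i (i.2 + 1) (Or.inr rfl) h
          obtain ⟨g', j, hj⟩ := i
          simp only [add_left_inj] at h2 h3
          subst h2 h3
          rfl
        · rintro rfl; rfl
      simp only [ha, hb, Finset.sum_add_distrib, Finset.sum_ite_eq', Finset.mem_univ,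
        if_true] at h1
      exact CharTwo.add_eq_zero.1 h1
  let p : Sym2 V → Bool → M := fun g s => if h : g ∈ E then q ⟨⟨g, h⟩, 0, hpos _⟩ s else 0
  have hp : ∀ (g : E) s, p g.1 s = q ⟨g, 0, hpos g⟩ s := fun g s => by simp [p]
  refine ⟨p, fun g hgE => ?_, fun F x => ?_, fun F hF g hgE s => ?_⟩
  · rw [hp ⟨g, hgE⟩, hp ⟨g, hgE⟩, hq1]
  · have h1 := hq2 F (D.point x)
    rw [Finset.sum_filter, ← Finset.sum_coe_sort E]
    have h2 := sum_ends_polylines CharTwo.add_self_eq_zero n (fun g k => (L g).getD k 0)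
      (fun g => F (p g.1 true) + F (p g.1 false)) (D.point x)
    refine Eq.trans ?_ ((h2.symm.trans ?_).trans h1)
    · exact Finset.sum_congr rfl fun g _ =>
        ite_eq_add_ite hpt (hnotboth g _) _
    · refine Finset.sum_congr rfl fun i _ => ?_
      rw [hp, hp, ← hstep F i.1 i.2 i.2.2]
  · rw [hp ⟨g, hgE⟩]
    refine hq3 F (fun i => ?_) _ s
    apply CharTwo.add_eq_zero.1
    rw [hstep F i.1 i.2 i.2.2, ← hp, ← hp, hF _ i.1.2]
    exact CharTwo.add_self_eq_zero _

end PlanarPruning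

/-! ### Joins of minimum weight -/

namespace PlanarPruning

/-- A refinement of the weight `w`: ties are broken first by the number of edges and then by
distinct powers of two, so that distinct sets of edges have distinct weights. -/
def tieWeight {V : Type*} (w : Sym2 V → ℕ) (φ : Sym2 V → ℕ) (g : Sym2 V) : ℕ ×ₗ ℕ ×ₗ ℕ :=
  toLex (w g, toLex (1, 2 ^ φ g))

theorem tieWeight_nonneg {V : Type*} (w : Sym2 V → ℕ) (φ : Sym2 V → ℕ) (g : Sym2 V) :
    0 ≤ tieWeight w φ g := by
  refine Prod.Lex.toLex_le_toLex.2 ?_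
  rcases (w g).eq_zero_or_pos with h | h
  · exact Or.inr ⟨h.symm, Prod.Lex.toLex_le_toLex.2 (Or.inl Nat.one_pos)⟩
  · exact Or.inl h

section Parity

variable {V : Type*} [DecidableEq V]

/-- The degree of a vertex in a set of edges, modulo 2. -/
def parity (B : Finset (Sym2 V)) (v : V) : ZMod 2 :=
  ∑ g ∈ B, if v ∈ g then 1 else 0

theorem sum_symmDiff {ι : Type*} [DecidableEq ι] (B C : Finset ι) (f : ι → ZMod 2) :
    ∑ g ∈ symmDiff B C, f g = ∑ g ∈ B, f g + ∑ g ∈ C, f g := by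
  have h1 : symmDiff B C = (B \ C) ∪ (C \ B) := rfl
  rw [h1, Finset.sum_union (disjoint_sdiff_sdiff), ← Finset.sum_inter_add_sum_sdiff B C,
    ← Finset.sum_inter_add_sum_sdiff C B, Finset.inter_comm C B]
  linear_combination -CharTwo.add_self_eq_zero (∑ g ∈ B ∩ C, f g)

theorem parity_symmDiff (B C : Finset (Sym2 V)) (v : V) :
    parity (symmDiff B C) v = parity B v + parity C v :=
  sum_symmDiff B C _

theorem parity_singleton {a b : V} (hab : a ≠ b) (v : V) :
    parity {s(a, b)} v = (if v = a then 1 else 0) + (if v = b then 1 else 0) := by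
  simp only [parity, Finset.sum_singleton, Sym2.mem_iff]
  by_cases h : v = a
  · subst h; simp [hab]
  · simp [h]

theorem sum_map_edges {K : SimpleGraph V} {a b : V} (p : K.Walk a b) (v : V) :
    (p.edges.map fun g => if v ∈ g then (1 : ZMod 2) else 0).sum =
      (if v = a then 1 else 0) + (if v = b then 1 else 0) := by
  induction p with
  | nil => simp [CharTwo.add_self_eq_zero]
  | @cons a c b h p ih =>
    rw [SimpleGraph.Walk.edges_cons, List.map_cons, List.sum_cons, ih]
    have h2 := parity_singleton (K.ne_of_adj h) v
    simp only [parity, Finset.sum_singleton] at h2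
    rw [h2]
    linear_combination CharTwo.add_self_eq_zero (if v = c then (1 : ZMod 2) else 0)

theorem parity_edges {K : SimpleGraph V} {a b : V} {p : K.Walk a b} (hp : p.edges.Nodup) (v : V) :
    parity p.edges.toFinset v = (if v = a then 1 else 0) + (if v = b then 1 else 0) := by
  rw [parity, List.sum_toFinset _ hp, sum_map_edges]

/-- A set of edges with exactly two vertices `a` and `b` of odd degree contains a path between
them: the degrees in the connected component of `a` sum to an even number. -/
theorem exists_path_of_parity [Fintype V] {K : SimpleGraph V} {J : Finset (Sym2 V)}
    (hJ : ∀ g ∈ J, g ∈ K.edgeSet) {a b : V}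
    (h : ∀ v, parity J v = (if v = a then 1 else 0) + (if v = b then 1 else 0)) :
    ∃ p : K.Walk a b, p.IsPath ∧ ∀ g ∈ p.edges, g ∈ J := by
  classical
  let Q : SimpleGraph V := SimpleGraph.fromEdgeSet (J : Set (Sym2 V))
  have hQ : Q ≤ K := by
    intro x y hxy
    rw [SimpleGraph.fromEdgeSet_adj] at hxy
    exact hJ _ hxy.1
  let U : Finset V := {x | Q.Reachable a x}
  have hU : ∀ x, x ∈ U ↔ Q.Reachable a x := by simp [U]
  have h1 : ∑ x ∈ U, parity J x = 0 := by
    unfold parity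
    rw [Finset.sum_comm]
    refine Finset.sum_eq_zero fun g hg => ?_
    have hgK := hJ g hg
    induction g using Sym2.ind with
    | _ x y =>
      have hne : x ≠ y := K.ne_of_adj hgK
      have hadj : Q.Adj x y := by
        rw [SimpleGraph.fromEdgeSet_adj]; exact ⟨hg, hne⟩
      have hiff : x ∈ U ↔ y ∈ U := by
        rw [hU, hU]
        exact ⟨fun h => h.trans hadj.reachable, fun h => h.trans hadj.symm.reachable⟩
      have h2 : ∀ v, (if v ∈ s(x, y) then (1 : ZMod 2) else 0) =
          (if v = x then 1 else 0) + (if v = y then 1 else 0) := by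
        intro v
        have := parity_singleton hne v
        simpa only [parity, Finset.sum_singleton] using this
      simp only [h2, Finset.sum_add_distrib, Finset.sum_ite_eq', hiff]
      exact CharTwo.add_self_eq_zero _
  have hb : b ∈ U := by
    simp only [h, Finset.sum_add_distrib, Finset.sum_ite_eq'] at h1
    by_contra hb
    simp [hb, hU] at h1
  obtain ⟨q⟩ := (hU b).1 hb
  refine ⟨q.bypass.mapLe hQ, ?_, fun g hg => ?_⟩
  · exact (SimpleGraph.Walk.isPath_mapLe hQ).2 q.bypass_isPath
  · rw [SimpleGraph.Walk.edges_mapLe_eq_edges] at hg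
    have := SimpleGraph.Walk.edges_subset_edgeSet _ hg
    rw [SimpleGraph.edgeSet_fromEdgeSet] at this
    exact this.1

/-- `J` is the only set of minimum weight among the subsets of `E` with the parities `t`. -/
def IsMinJoin {Λ : Type*} [AddCommMonoid Λ] [LinearOrder Λ] (W : Sym2 V → Λ)
    (E : Finset (Sym2 V)) (t : V → ZMod 2) (J : Finset (Sym2 V)) : Prop :=
  J ⊆ E ∧ parity J = t ∧
    ∀ J' ⊆ E, parity J' = t → J' ≠ J → ∑ g ∈ J, W g < ∑ g ∈ J', W g

/-- Exchanging a minimum join along a nonempty even set of edges increases its weight. -/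
theorem IsMinJoin.lt_of_even {Λ : Type*} [AddCommMonoid Λ] [LinearOrder Λ]
    [IsOrderedCancelAddMonoid Λ] {W : Sym2 V → Λ} {E : Finset (Sym2 V)} {t : V → ZMod 2}
    {J : Finset (Sym2 V)} (hJ : IsMinJoin W E t J) {B : Finset (Sym2 V)} (hB : B ⊆ E)
    (hB0 : parity B = 0) (hne : B.Nonempty) :
    ∑ g ∈ B ∩ J, W g < ∑ g ∈ B \ J, W g := by
  have h1 : symmDiff J B ⊆ E := fun g hg => by
    rcases Finset.mem_symmDiff.1 hg with h | h
    · exact hJ.1 h.1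
    · exact hB h.1
  have h2 : parity (symmDiff J B) = t := by
    ext v
    rw [parity_symmDiff, hB0, hJ.2.1]
    simp
  have h3 : symmDiff J B ≠ J := by
    rw [Ne, symmDiff_eq_left]
    exact hne.ne_empty
  have h4 := hJ.2.2 _ h1 h2 h3
  have h5 : symmDiff J B = (J \ B) ∪ (B \ J) := rfl
  rw [h5, Finset.sum_union (disjoint_sdiff_sdiff), ← Finset.sum_inter_add_sum_sdiff J B,
    add_comm, Finset.inter_comm] at h4
  exact lt_of_add_lt_add_left h4

/-- The union of two unique minimum joins is acyclic: exchanging along a nonempty even set of edges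
would have to increase the weight of both joins. -/
theorem IsMinJoin.eq_empty_of_even {Λ : Type*} [AddCommMonoid Λ] [LinearOrder Λ]
    [IsOrderedCancelAddMonoid Λ] {W : Sym2 V → Λ} (hW : ∀ g, 0 ≤ W g) {E : Finset (Sym2 V)} {t₁ t₂ : V → ZMod 2}
    {J₁ J₂ : Finset (Sym2 V)} (h₁ : IsMinJoin W E t₁ J₁) (h₂ : IsMinJoin W E t₂ J₂)
    {B : Finset (Sym2 V)} (hB : B ⊆ J₁ ∪ J₂) (hB0 : parity B = 0) : B = ∅ := by
  by_contra hne
  have hne := Finset.nonempty_iff_ne_empty.2 hne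
  have hBE := hB.trans (Finset.union_subset h₁.1 h₂.1)
  have key : ∀ J J' : Finset (Sym2 V), B ⊆ J ∪ J' → ∑ g ∈ B \ J, W g ≤ ∑ g ∈ B ∩ J', W g := by
    intro J J' h
    refine Finset.sum_le_sum_of_subset_of_nonneg (fun g hg => ?_) fun g _ _ => hW g
    have := h (Finset.mem_sdiff.1 hg).1
    simp only [Finset.mem_sdiff, Finset.mem_inter, Finset.mem_union] at *
    tauto
  refine lt_irrefl (∑ g ∈ B ∩ J₁, W g) ?_
  calc ∑ g ∈ B ∩ J₁, W g < ∑ g ∈ B \ J₁, W g := h₁.lt_of_even hBE hB0 hne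
    _ ≤ ∑ g ∈ B ∩ J₂, W g := key _ _ hB
    _ < ∑ g ∈ B \ J₂, W g := h₂.lt_of_even hBE hB0 hne
    _ ≤ ∑ g ∈ B ∩ J₁, W g := key _ _ (by rwa [Finset.union_comm])

theorem sum_tieWeight (w : Sym2 V → ℕ) (φ : Sym2 V → ℕ) (J : Finset (Sym2 V)) :
    ∑ g ∈ J, tieWeight w φ g =
      toLex (∑ g ∈ J, w g, toLex (J.card, ∑ g ∈ J, 2 ^ φ g)) := by
  induction J using Finset.induction_on with
  | empty => rfl
  | insert a s ha ih =>
    rw [Finset.sum_insert ha, ih, Finset.sum_insert ha, Finset.sum_insert ha,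
      Finset.card_insert_of_notMem ha, add_comm s.card 1]
    rfl

theorem sum_tieWeight_injective (w : Sym2 V → ℕ) {φ : Sym2 V → ℕ} (hφ : Function.Injective φ) :
    Function.Injective fun J : Finset (Sym2 V) => ∑ g ∈ J, tieWeight w φ g := by
  intro J J' h
  simp only [sum_tieWeight] at h
  have h1 : ∑ g ∈ J, 2 ^ φ g = ∑ g ∈ J', 2 ^ φ g :=
    congrArg (fun z : ℕ ×ₗ ℕ ×ₗ ℕ => (ofLex (ofLex z).2).2) h
  rw [← Finset.sum_image (f := fun i => 2 ^ i) hφ.injOn,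
    ← Finset.sum_image (f := fun i => 2 ^ i) hφ.injOn] at h1
  exact Finset.image_injective hφ (Finset.geomSum_injective le_rfl h1)

theorem exists_isMinJoin {w : Sym2 V → ℕ} {φ : Sym2 V → ℕ} (hφ : Function.Injective φ)
    {E : Finset (Sym2 V)} {t : V → ZMod 2} (h : ∃ J ⊆ E, parity J = t) :
    ∃ J, IsMinJoin (tieWeight w φ) E t J := by
  classical
  obtain ⟨J₀, h0, h0'⟩ := h
  obtain ⟨J, hJ, hmin⟩ := Finset.exists_min_image (E.powerset.filter fun J => parity J = t)
    (fun J => ∑ g ∈ J, tieWeight w φ g) ⟨J₀, by simp [h0, h0']⟩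
  simp only [Finset.mem_filter, Finset.mem_powerset] at hJ hmin
  exact ⟨J, hJ.1, hJ.2, fun J' h1 h2 hne => lt_of_le_of_ne (hmin J' ⟨h1, h2⟩) fun he =>
    hne (sum_tieWeight_injective w hφ he.symm)⟩

theorem IsMinJoin.sum_le {w : Sym2 V → ℕ} {φ : Sym2 V → ℕ} {E : Finset (Sym2 V)}
    {t : V → ZMod 2} {J : Finset (Sym2 V)} (hJ : IsMinJoin (tieWeight w φ) E t J)
    {J' : Finset (Sym2 V)} (h1 : J' ⊆ E) (h2 : parity J' = t) :
    ∑ g ∈ J, w g ≤ ∑ g ∈ J', w g := by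
  by_cases hne : J' = J
  · rw [hne]
  · have := hJ.2.2 J' h1 h2 hne
    rw [sum_tieWeight, sum_tieWeight, Prod.Lex.toLex_lt_toLex] at this
    rcases this with h | h
    · exact h.le
    · exact h.1.le

/-- If an edge of `E` has at most the weight of the minimum join of its ends, then it is that
join: any other join has more than one edge. -/
theorem IsMinJoin.eq_singleton {w : Sym2 V → ℕ} {φ : Sym2 V → ℕ} {E : Finset (Sym2 V)}
    {a b : V} (hab : a ≠ b) {J : Finset (Sym2 V)}
    (hJ : IsMinJoin (tieWeight w φ) E (parity {s(a, b)}) J) (he : s(a, b) ∈ E)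
    (hw : w s(a, b) ≤ ∑ g ∈ J, w g) : J = {s(a, b)} := by
  by_contra hne
  have h := hJ.2.2 {s(a, b)} (by simpa using he) rfl (Ne.symm hne)
  rw [sum_tieWeight, sum_tieWeight, Prod.Lex.toLex_lt_toLex] at h
  simp only [Finset.sum_singleton, Prod.Lex.toLex_lt_toLex, Finset.card_singleton] at h
  have hpar : parity J a = 1 := by
    rw [hJ.2.1, parity_singleton hab]; simp [hab]
  have hmem : ∀ {g : Sym2 V} {v : V}, parity {g} v = 1 → v ∈ g := by
    intro g v h
    by_contra hc
    simp only [parity, Finset.sum_singleton, if_neg hc, zero_ne_one] at h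
  have hcard : J.card ≤ 1 := by omega
  have hne0 : J ≠ ∅ := by rintro rfl; simp [parity] at hpar
  obtain ⟨g, rfl⟩ := Finset.card_eq_one.1 (hcard.antisymm
    (Finset.card_pos.2 (Finset.nonempty_iff_ne_empty.2 hne0)))
  have hb : parity {g} b = 1 := by
    rw [hJ.2.1, parity_singleton hab]; simp [hab.symm]
  exact hne (by rw [(Sym2.mem_and_mem_iff hab).1 ⟨hmem hpar, hmem hb⟩])

/-- A minimum join of two vertices is the set of edges of a path. -/
theorem IsMinJoin.exists_path [Fintype V] {K : SimpleGraph V} {Λ : Type*} [AddCommMonoid Λ]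
    [LinearOrder Λ] [IsOrderedCancelAddMonoid Λ] {W : Sym2 V → Λ} (hW : ∀ g, 0 ≤ W g)
    {E : Finset (Sym2 V)} (hE : ∀ g ∈ E, g ∈ K.edgeSet) {a b : V} (hab : a ≠ b)
    {J : Finset (Sym2 V)} (hJ : IsMinJoin W E (parity {s(a, b)}) J) :
    ∃ p : K.Walk a b, p.IsPath ∧ p.edges.toFinset = J := by
  obtain ⟨p, hp, hpJ⟩ := exists_path_of_parity (K := K) (J := J) (a := a) (b := b)
    (fun g hg => hE g (hJ.1 hg)) fun v => by rw [hJ.2.1, parity_singleton hab]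
  refine ⟨p, hp, ?_⟩
  have hsub : p.edges.toFinset ⊆ J := fun g hg => hpJ g (by simpa using hg)
  by_contra hne
  have h1 := hJ.2.2 p.edges.toFinset (hsub.trans hJ.1) (by
    ext v
    rw [parity_edges hp.isTrail.edges_nodup, parity_singleton hab]) hne
  exact absurd (Finset.sum_le_sum_of_subset_of_nonneg hsub fun g _ _ => hW g) (not_le.2 h1)

end Parity

end PlanarPruning

/-! ### Laminar families of regions -/

namespace PlanarPruning

section Charging

variable {β ξ : Type*} {E : Finset β} {X : Finset ξ} {J : ξ → Finset β}
  {R : ξ → Finset (β × Bool)}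

/-- A laminar family of regions with boundaries. The regions `R e` are sets of sides of the edges in
`E`, and the boundary `J e` of `R e` consists of the edges that have exactly one of their sides in
`R e`. -/
structure IsRegionSystem (E : Finset β) (X : Finset ξ) (J : ξ → Finset β)
    (R : ξ → Finset (β × Bool)) : Prop where
  subset : ∀ e ∈ X, J e ⊆ E
  mem_iff : ∀ e ∈ X, ∀ g ∈ E, g ∈ J e ↔ ((g, true) ∈ R e ↔ (g, false) ∉ R e)
  laminar : ∀ e ∈ X, ∀ f ∈ X, Disjoint (R e) (R f) ∨ R e ⊆ R f ∨ R f ⊆ R e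

namespace IsRegionSystem

theorem exists_side (h : IsRegionSystem E X J R) {e : ξ} (he : e ∈ X) {g : β} (hg : g ∈ J e) :
    ∃ s, (g, s) ∈ R e ∧ (g, !s) ∉ R e := by
  have h1 := (h.mem_iff e he g (h.subset e he hg)).1 hg
  by_cases ht : (g, true) ∈ R e
  · exact ⟨true, ht, h1.1 ht⟩
  · exact ⟨false, by_contra fun hf => ht (h1.2 hf), ht⟩

theorem mem_of_sides (h : IsRegionSystem E X J R) {e : ξ} (he : e ∈ X) {g : β} (hg : g ∈ E)
    {s : Bool} (h1 : (g, s) ∈ R e) (h2 : (g, !s) ∉ R e) : g ∈ J e := by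
  rw [h.mem_iff e he g hg]
  cases s <;> simp_all

theorem opposite_notMem (h : IsRegionSystem E X J R) {e : ξ} (he : e ∈ X) {g : β} {s : Bool}
    (hg : g ∈ J e) (hs : (g, s) ∈ R e) : (g, !s) ∉ R e := by
  have h1 := (h.mem_iff e he g (h.subset e he hg)).1 hg
  cases s <;> simp_all

end IsRegionSystem

variable [DecidableEq β]

/-- The inner sides of the boundary edges of a region. -/
def innerSides (J : ξ → Finset β) (R : ξ → Finset (β × Bool)) (e : ξ) : Finset (β × Bool) :=
  {x ∈ R e | x.1 ∈ J e}

theorem mem_innerSides {e : ξ} {x : β × Bool} :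
    x ∈ innerSides J R e ↔ x ∈ R e ∧ x.1 ∈ J e := by
  simp [innerSides]

/-- A region `e` hangs on a region `f` around it if two thirds of the value of `e` are boundary
common to both. -/
def Hangs (J : ξ → Finset β) (R : ξ → Finset (β × Bool)) (w : β → ℕ) (ω : ξ → ℕ) (e f : ξ) :
    Prop :=
  R e ⊆ R f ∧ 2 * ω e ≤ 3 * ∑ g ∈ J e ∩ J f, w g

namespace IsRegionSystem

theorem injOn_fst (h : IsRegionSystem E X J R) {e : ξ} (he : e ∈ X) :
    Set.InjOn Prod.fst (innerSides J R e : Set (β × Bool)) := by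
  rintro ⟨g, s⟩ hx ⟨g', s'⟩ hy hgg
  simp only at hgg
  subst hgg
  simp only [Finset.mem_coe, mem_innerSides] at hx hy
  have h1 := h.opposite_notMem he hx.2 hx.1
  by_cases hs : s = s'
  · rw [hs]
  · rw [show s' = !s by cases s <;> cases s' <;> simp_all] at hy
    exact absurd hy.1 h1

/-- Two nested regions lie on the same side of their common boundary edges. -/
theorem sum_inner_inter (h : IsRegionSystem E X J R) {e f : ξ} (he : e ∈ X)
    (hef : R e ⊆ R f) (w : β → ℕ) :
    ∑ x ∈ innerSides J R e ∩ innerSides J R f, w x.1 = ∑ g ∈ J e ∩ J f, w g := by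
  have h1 : (innerSides J R e ∩ innerSides J R f).image Prod.fst = J e ∩ J f := by
    ext g
    simp only [Finset.mem_image, Finset.mem_inter, mem_innerSides]
    constructor
    · rintro ⟨x, ⟨⟨-, h1⟩, -, h2⟩, rfl⟩
      exact ⟨h1, h2⟩
    · rintro ⟨h1, h2⟩
      obtain ⟨s, hs, -⟩ := h.exists_side he h1
      exact ⟨(g, s), ⟨⟨hs, h1⟩, hef hs, h2⟩, rfl⟩
  rw [← h1, Finset.sum_image]
  exact (h.injOn_fst he).mono fun x hx => (Finset.mem_inter.1 hx).1

/-- An inner side of a region that lies in a smaller region is an inner side of that one, too: its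
opposite side is outside the larger region, hence outside the smaller. -/
theorem mem_innerSides_of_subset (h : IsRegionSystem E X J R) {d d₀ : ξ}
    (hd : d ∈ X) (hd₀ : d₀ ∈ X) (h2 : R d₀ ⊆ R d) {x : β × Bool}
    (hx : x ∈ innerSides J R d) (hx₀ : x ∈ R d₀) : x ∈ innerSides J R d₀ := by
  obtain ⟨g, s⟩ := x
  rw [mem_innerSides] at *
  refine ⟨hx₀, h.mem_of_sides hd₀ (h.subset d hd hx.2) hx₀ fun hc => ?_⟩
  exact h.opposite_notMem hd hx.2 hx.1 (h2 hc)

/-- The traces of the boundaries of regions on the boundary of a region around them form a laminar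
family. -/
theorem inter_laminar (h : IsRegionSystem E X J R) {e e' f : ξ} (he : e ∈ X) (he' : e' ∈ X)
    (hf : f ∈ X) (hef : R e ⊆ R f) (hef' : R e' ⊆ R f) :
    Disjoint (J e ∩ J f) (J e' ∩ J f) ∨ J e ∩ J f ⊆ J e' ∩ J f ∨ J e' ∩ J f ⊆ J e ∩ J f := by
  have key : ∀ e ∈ X, ∀ e' ∈ X, R e ⊆ R f → R e' ⊆ R f → R e ⊆ R e' →
      J e ∩ J f ⊆ J e' ∩ J f := by
    intro e he e' he' hef hef' hsub g hg
    rw [Finset.mem_inter] at hg ⊢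
    obtain ⟨s, hs, -⟩ := h.exists_side he hg.1
    have h2 : (g, s) ∈ innerSides J R f := mem_innerSides.2 ⟨hef hs, hg.2⟩
    exact ⟨(mem_innerSides.1 (h.mem_innerSides_of_subset hf he' hef' h2 (hsub hs))).2, hg.2⟩
  rcases h.laminar e he e' he' with h1 | h1 | h1
  · left
    rw [Finset.disjoint_left]
    intro g hg hg'
    rw [Finset.mem_inter] at hg hg'
    obtain ⟨s, hs, -⟩ := h.exists_side he hg.1
    obtain ⟨s', hs', -⟩ := h.exists_side he' hg'.1
    have := h.injOn_fst hf (mem_innerSides.2 ⟨hef hs, hg.2⟩ : (g, s) ∈ innerSides J R f)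
      (mem_innerSides.2 ⟨hef' hs', hg.2⟩ : (g, s') ∈ innerSides J R f) rfl
    rw [← this] at hs'
    exact Finset.disjoint_left.1 h1 hs hs'
  · exact Or.inr (Or.inl (key e he e' he' hef hef' h1))
  · exact Or.inr (Or.inr (key e' he' e he hef' hef h1))

open scoped Classical in
/-- There is a set `D` of regions such that each region hangs on one in `D`, and the
boundaries of the regions in `D` have at most three times the weight of the union of their inner
sides. The set is found by going through the regions from the largest to the smallest and taking
those that hang on none taken before: at least a third of the inner sides of such a region is
new, as its overlap with those taken before is that with the smallest one around it. -/
theorem exists_heads (h : IsRegionSystem E X J R) (w : β → ℕ) (ω : ξ → ℕ)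
    (hω : ∀ e ∈ X, ω e ≤ ∑ g ∈ J e, w g) :
    ∃ D ⊆ X, (∀ e ∈ X, ∃ f ∈ D, Hangs J R w ω e f) ∧
      ∑ f ∈ D, ∑ g ∈ J f, w g ≤ 3 * ∑ x ∈ D.biUnion (innerSides J R), w x.1 := by
  suffices H : ∀ X' ⊆ X, ∃ D ⊆ X', (∀ e ∈ X', ∃ f ∈ D, Hangs J R w ω e f) ∧
      ∑ f ∈ D, ∑ g ∈ J f, w g ≤ 3 * ∑ x ∈ D.biUnion (innerSides J R), w x.1 from H X subset_rfl
  intro X'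
  induction X' using Finset.induction_on_min_value (fun e => (R e).card) with
  | empty => exact fun _ => ⟨∅, by simp, by simp, by simp⟩
  | insert a s ha hmin ih =>
    intro hX
    have haX : a ∈ X := hX (by simp)
    obtain ⟨D, hDs, hD, hDw⟩ := ih ((Finset.subset_insert a s).trans hX)
    have hDX : D ⊆ X := hDs.trans ((Finset.subset_insert a s).trans hX)
    by_cases hex : ∃ f ∈ D, Hangs J R w ω a f
    · refine ⟨D, hDs.trans (Finset.subset_insert a s), fun e he => ?_, hDw⟩
      rcases Finset.mem_insert.1 he with rfl | he
      · exact hex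
      · exact hD e he
    · push Not at hex
      have haD : a ∉ D := fun hc => ha (hDs hc)
      refine ⟨insert a D, Finset.insert_subset_insert a hDs, fun e he => ?_, ?_⟩
      · rcases Finset.mem_insert.1 he with rfl | he
        · refine ⟨e, by simp, subset_rfl, ?_⟩
          have := hω e haX
          rw [Finset.inter_self]
          omega
        · obtain ⟨f, hf, hf'⟩ := hD e he
          exact ⟨f, Finset.mem_insert_of_mem hf, hf'⟩
      · have hself := h.sum_inner_inter haX subset_rfl w
        rw [Finset.inter_self, Finset.inter_self] at hself
        have hold : 3 * ∑ x ∈ innerSides J R a ∩ D.biUnion (innerSides J R), w x.1 ≤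
            2 * ∑ g ∈ J a, w g := by
          by_cases hd : (D.filter fun d => R a ⊆ R d).Nonempty
          · obtain ⟨d₀, hd₀, hd₀min⟩ := Finset.exists_min_image _ (fun d => (R d).card) hd
            simp only [Finset.mem_filter] at hd₀ hd₀min
            have hd₀X := hDX hd₀.1
            have hsub : innerSides J R a ∩ D.biUnion (innerSides J R) ⊆
                innerSides J R a ∩ innerSides J R d₀ := by
              intro x hx
              rw [Finset.mem_inter, Finset.mem_biUnion] at hx
              obtain ⟨hxa, d, hd, hxd⟩ := hx
              refine Finset.mem_inter.2 ⟨hxa, ?_⟩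
              have hxa' := (mem_innerSides.1 hxa).1
              have hxd' := (mem_innerSides.1 hxd).1
              have hdX := hDX hd
              have hx₀ : x ∈ R d₀ := hd₀.2 hxa'
              have had : R a ⊆ R d := by
                rcases h.laminar a haX d hdX with h1 | h1 | h1
                · exact absurd hxd' (Finset.disjoint_left.1 h1 hxa')
                · exact h1
                · exact (Finset.eq_of_subset_of_card_le h1 (hmin d (hDs hd))).symm.subset
              refine h.mem_innerSides_of_subset hdX hd₀X ?_ hxd hx₀
              rcases h.laminar d₀ hd₀X d hdX with h1 | h1 | h1
              · exact absurd hxd' (Finset.disjoint_left.1 h1 hx₀)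
              · exact h1
              · exact (Finset.eq_of_subset_of_card_le h1 (hd₀min d ⟨hd, had⟩)).symm.subset
            have h1 := Finset.sum_le_sum_of_subset (f := fun x => w x.1) hsub
            rw [h.sum_inner_inter haX hd₀.2] at h1
            have h2 : ¬ 2 * ω a ≤ 3 * ∑ g ∈ J a ∩ J d₀, w g := fun hc =>
              hex d₀ hd₀.1 ⟨hd₀.2, hc⟩
            have h3 := hω a haX
            omega
          · have hempty : innerSides J R a ∩ D.biUnion (innerSides J R) = ∅ := by
              rw [Finset.eq_empty_iff_forall_notMem]
              intro x hx
              rw [Finset.mem_inter, Finset.mem_biUnion] at hx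
              obtain ⟨hxa, d, hdD, hxd⟩ := hx
              have hxa' := (mem_innerSides.1 hxa).1
              have hxd' := (mem_innerSides.1 hxd).1
              apply hd
              refine ⟨d, Finset.mem_filter.2 ⟨hdD, ?_⟩⟩
              rcases h.laminar a haX d (hDX hdD) with h1 | h1 | h1
              · exact absurd hxd' (Finset.disjoint_left.1 h1 hxa')
              · exact h1
              · exact (Finset.eq_of_subset_of_card_le h1 (hmin d (hDs hdD))).symm.subset
            rw [hempty]
            simp
        have hsplit := Finset.sum_inter_add_sum_sdiff (innerSides J R a)
          (D.biUnion (innerSides J R)) (fun x => w x.1)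
        have hunion : ∑ x ∈ (insert a D).biUnion (innerSides J R), w x.1 =
            ∑ x ∈ innerSides J R a \ D.biUnion (innerSides J R), w x.1 +
              ∑ x ∈ D.biUnion (innerSides J R), w x.1 := by
          rw [Finset.biUnion_insert, ← Finset.sdiff_union_self_eq_union,
            Finset.sum_union Finset.sdiff_disjoint]
        rw [Finset.sum_insert haD, hunion]
        omega

open scoped Classical in
/-- Some region carries, relative to the weight of its boundary, a sixth of the average value:
a factor of three is lost to `exists_heads`, and a factor of two as each edge has two sides. -/
theorem exists_heavy (h : IsRegionSystem E X J R) (hX : X.Nonempty) (w : β → ℕ) (ω : ξ → ℕ)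
    (hω : ∀ e ∈ X, ω e ≤ ∑ g ∈ J e, w g) :
    ∃ f ∈ X, (∑ e ∈ X, ω e) * ∑ g ∈ J f, w g ≤
      6 * (∑ g ∈ E, w g) * ∑ e ∈ X with Hangs J R w ω e f, ω e := by
  obtain ⟨D, hDX, hD, hDw⟩ := h.exists_heads w ω hω
  by_contra! hcon
  have hDne : D.Nonempty := by
    obtain ⟨e, he⟩ := hX
    obtain ⟨f, hf, -⟩ := hD e he
    exact ⟨f, hf⟩
  have h1 := Finset.sum_lt_sum_of_nonempty hDne fun f hf => hcon f (hDX hf)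
  rw [← Finset.mul_sum, ← Finset.mul_sum] at h1
  have h2 : ∑ e ∈ X, ω e ≤ ∑ f ∈ D, ∑ e ∈ X with Hangs J R w ω e f, ω e := by
    simp_rw [Finset.sum_filter]
    rw [Finset.sum_comm]
    refine Finset.sum_le_sum fun e he => ?_
    obtain ⟨f, hf, hef⟩ := hD e he
    refine le_trans ?_ (Finset.single_le_sum (fun _ _ => Nat.zero_le _) hf)
    rw [if_pos hef]
  have h3 : ∑ x ∈ D.biUnion (innerSides J R), w x.1 ≤ 2 * ∑ g ∈ E, w g := by
    have h4 : D.biUnion (innerSides J R) ⊆ E ×ˢ (Finset.univ : Finset Bool) := by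
      intro x hx
      obtain ⟨d, hd, hxd⟩ := Finset.mem_biUnion.1 hx
      simpa using h.subset d (hDX hd) (mem_innerSides.1 hxd).2
    refine (Finset.sum_le_sum_of_subset h4).trans_eq ?_
    rw [Finset.sum_product, Finset.mul_sum]
    simp [two_mul]
  have h5 : (∑ e ∈ X, ω e) * ∑ f ∈ D, ∑ g ∈ J f, w g ≤
      (6 * ∑ g ∈ E, w g) * ∑ f ∈ D, ∑ e ∈ X with Hangs J R w ω e f, ω e := by
    rw [mul_comm]
    exact Nat.mul_le_mul (by omega) h2
  omega

end IsRegionSystem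

end Charging

section Cycles

variable {V : Type*} [DecidableEq V]

theorem zmod_two_cases (a : ZMod 2) : a = 0 ∨ a = 1 := by
  revert a; decide

theorem add_eq_ite_ne (a b : ZMod 2) : a + b = if a ≠ b then 1 else 0 := by
  revert a b; decide

/-- The insides of two cycles `J e ∪ {e}` and `J f ∪ {f}`, where `J e ∪ J f` is acyclic, are
laminar. Of the four combinations of inside and outside, neither `e` nor `f` is on the boundary of
the one that avoids both; as the boundary is an even set of edges, it is empty. -/
theorem laminar_of_side_labels {Λ : Type*} [AddCommMonoid Λ] [LinearOrder Λ]
    [IsOrderedCancelAddMonoid Λ] {W : Sym2 V → Λ} (hW : ∀ g, 0 ≤ W g)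
    {E E' : Finset (Sym2 V)} {t₁ t₂ : V → ZMod 2} {J : Sym2 V → Finset (Sym2 V)} {e f : Sym2 V}
    (he : e ∈ E) (hf : f ∈ E) (heE : e ∉ E') (hfE : f ∉ E') (hef : e ≠ f)
    (hJe : IsMinJoin W E' t₁ (J e)) (hJf : IsMinJoin W E' t₂ (J f))
    {p : Sym2 V → Bool → Sym2 V → ZMod 2}
    (h1e : ∀ g ∈ E, p g true e + p g false e = if g ∈ insert e (J e) then 1 else 0)
    (h1f : ∀ g ∈ E, p g true f + p g false f = if g ∈ insert f (J f) then 1 else 0)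
    (h2 : ∀ (F : (Sym2 V → ZMod 2) → ZMod 2) (v : V),
      ∑ g ∈ E with v ∈ g, (F (p g true) + F (p g false)) = 0)
    (h3 : ∀ F : (Sym2 V → ZMod 2) → ZMod 2, (∀ g ∈ E, F (p g true) = F (p g false)) →
        ∀ g ∈ E, ∀ s, F (p g s) = F 0) :
    (∀ g ∈ E, ∀ s, ¬ (p g s e = 1 ∧ p g s f = 1)) ∨
      (∀ g ∈ E, ∀ s, p g s e = 1 → p g s f = 1) ∨ (∀ g ∈ E, ∀ s, p g s f = 1 → p g s e = 1) := by
  have hpe : p e true f = p e false f := by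
    have := h1f e he
    rw [if_neg] at this
    · exact CharTwo.add_eq_zero.1 this
    · rw [Finset.mem_insert]; rintro (h | h)
      · exact hef h
      · exact heE (hJf.1 h)
  have hpf : p f true e = p f false e := by
    have := h1e f hf
    rw [if_neg] at this
    · exact CharTwo.add_eq_zero.1 this
    · rw [Finset.mem_insert]; rintro (h | h)
      · exact hef h.symm
      · exact hfE (hJe.1 h)
  obtain ⟨v₁, hv₁⟩ : ∃ v, v = p f true e + 1 := ⟨_, rfl⟩
  obtain ⟨v₂, hv₂⟩ : ∃ v, v = p e true f + 1 := ⟨_, rfl⟩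
  let F : (Sym2 V → ZMod 2) → ZMod 2 := fun m => if m e = v₁ ∧ m f = v₂ then 1 else 0
  have hne : ∀ a : ZMod 2, a ≠ a + 1 := by decide
  have hFe : ∀ s, F (p e s) = 0 := by
    intro s
    refine if_neg fun hc => hne (p e true f) ?_
    rw [← hv₂, ← hc.2]
    cases s <;> simp [hpe]
  have hFf : ∀ s, F (p f s) = 0 := by
    intro s
    refine if_neg fun hc => hne (p f true e) ?_
    rw [← hv₁, ← hc.1]
    cases s <;> simp [hpf]
  let B : Finset (Sym2 V) := {g ∈ E | F (p g true) ≠ F (p g false)}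
  have hB0 : parity B = 0 := by
    ext v
    rw [Pi.zero_apply, ← h2 F v, parity, Finset.sum_filter, Finset.sum_filter]
    refine Finset.sum_congr rfl fun g _ => ?_
    rw [add_eq_ite_ne]
    by_cases hv : v ∈ g <;> simp [hv]
  have hB : B ⊆ J e ∪ J f := by
    intro g hg
    obtain ⟨hgE, hgF⟩ := Finset.mem_filter.1 hg
    by_contra hc
    rw [Finset.mem_union, not_or] at hc
    by_cases hge : g = e
    · rw [hge] at hgF; exact hgF (by rw [hFe, hFe])
    by_cases hgf : g = f
    · rw [hgf] at hgF; exact hgF (by rw [hFf, hFf])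
    have e1 := h1e g hgE
    have e2 := h1f g hgE
    rw [if_neg (by simp [hge, hc.1]), CharTwo.add_eq_zero] at e1
    rw [if_neg (by simp [hgf, hc.2]), CharTwo.add_eq_zero] at e2
    exact hgF (by simp only [F, e1, e2])
  have hBempty := IsMinJoin.eq_empty_of_even hW hJe hJf hB hB0
  have hconst := h3 F fun g hg => by
    by_contra hc
    have : g ∈ B := Finset.mem_filter.2 ⟨hg, hc⟩
    simp [hBempty] at this
  have hF0 : F 0 = 0 := by rw [← hconst e he true, hFe]
  have hno : ∀ g ∈ E, ∀ s, ¬ (p g s e = v₁ ∧ p g s f = v₂) := by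
    intro g hg s hc
    have := hconst g hg s
    rw [hF0] at this
    simp [F, hc] at this
  rcases zmod_two_cases v₁ with h4 | h4 <;> rcases zmod_two_cases v₂ with h5 | h5 <;>
    rw [h4, h5] at hno
  · simp [F, h4, h5] at hF0
  · refine Or.inr (Or.inr fun g hg s hs => ?_)
    rcases zmod_two_cases (p g s e) with h | h
    · exact absurd ⟨h, hs⟩ (hno g hg s)
    · exact h
  · refine Or.inr (Or.inl fun g hg s hs => ?_)
    rcases zmod_two_cases (p g s f) with h | h
    · exact absurd ⟨hs, h⟩ (hno g hg s)
    · exact h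
  · exact Or.inl hno

end Cycles

end PlanarPruning

/-! ### The regions of the edges of a planar graph -/

namespace PlanarPruning

open scoped Classical in
/-- The cycles that consist of the minimum join of the ends of an edge and of that edge bound
laminar regions. For an edge of `E'`, which is its own join, the two edges of the cycle coincide,
and one side of the edge serves as the region between them. -/
theorem IsPlanar.exists_regionSystem {V Λ : Type*} [Fintype V] {G : SimpleGraph V}
    (hG : IsPlanar G) [AddCommMonoid Λ] [LinearOrder Λ] [IsOrderedCancelAddMonoid Λ]
    {W : Sym2 V → Λ} (hW : ∀ g, 0 ≤ W g) {E E' X : Finset (Sym2 V)}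
    (hE : ∀ g, g ∈ E ↔ g ∈ G.edgeSet) (hE' : E' ⊆ E) (hX : X ⊆ E) {J : Sym2 V → Finset (Sym2 V)}
    (hJ : ∀ e ∈ X, IsMinJoin W E' (parity {e}) (J e))
    (hJself : ∀ e ∈ X, e ∈ E' → J e = {e}) :
    ∃ R, IsRegionSystem E' X J R := by
  have hnotMem : ∀ e ∈ X, e ∉ E' → e ∉ J e := fun e he he' hc => he' ((hJ e he).1 hc)
  let c : Sym2 V → Sym2 V → ZMod 2 := fun g e =>
    if (e ∈ X ∧ e ∉ E') ∧ g ∈ insert e (J e) then 1 else 0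
  have hc : ∀ v, ∑ g ∈ E with v ∈ g, c g = 0 := by
    intro v
    ext e
    rw [Finset.sum_apply, Pi.zero_apply]
    by_cases he : e ∈ X ∧ e ∉ E'
    · have h1 : ∑ g ∈ E with v ∈ g, c g e = parity (insert e (J e)) v := by
        rw [parity, Finset.sum_filter, ← Finset.sum_subset (s₁ := insert e (J e)) (s₂ := E)]
        · refine Finset.sum_congr rfl fun g hg => ?_
          by_cases hv : v ∈ g
          · simp only [hv, c, he, hg]; simp
          · simp [hv]
        · exact Finset.insert_subset (hX he.1) ((hJ e he.1).1.trans hE')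
        · intro g _ hg
          simp only [c, hg, and_false, if_false, ite_self]
      have h2 : parity (insert e (J e)) v = parity {e} v + parity (J e) v := by
        simp only [parity, Finset.sum_insert (hnotMem e he.1 he.2), Finset.sum_singleton]
      rw [h1, h2, (hJ e he.1).2.1]
      exact CharTwo.add_self_eq_zero _
    · exact Finset.sum_eq_zero fun g _ => if_neg fun h => he h.1
  obtain ⟨p, hp1, hp2, hp3⟩ := hG.exists_side_labels
    (M := Sym2 V → ZMod 2) (fun m => funext fun e => CharTwo.add_self_eq_zero (m e)) E hE c hc
  have hp1' : ∀ e ∈ X, e ∉ E' → ∀ g ∈ E, p g true e + p g false e =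
      if g ∈ insert e (J e) then 1 else 0 := by
    intro e he he' g hg
    rw [← Pi.add_apply, hp1 g hg]
    simp only [c, he, he', not_false_eq_true, true_and]
  refine ⟨fun e => if e ∈ E' then {(e, true)} else
    {x ∈ E' ×ˢ (Finset.univ : Finset Bool) | p x.1 x.2 e = 1}, fun e he => (hJ e he).1,
    fun e he g hg => ?_, fun e he f hf => ?_⟩
  · by_cases heE : e ∈ E'
    · simp only [heE, if_true, hJself e he heE, Finset.mem_singleton, Prod.mk.injEq]
      simp
    · have h1 := hp1' e he heE g (hE' hg)
      have hge : g ≠ e := by rintro rfl; exact heE hg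
      simp only [heE, if_false, Finset.mem_filter, Finset.mem_product, Finset.mem_univ, hg,
        and_self, true_and]
      simp only [Finset.mem_insert, hge, false_or] at h1
      by_cases hgJ : g ∈ J e
      · simp only [hgJ, if_true, true_iff] at h1 ⊢
        generalize p g true e = x at *
        generalize p g false e = y at *
        revert x y; decide
      · simp only [hgJ, if_false, false_iff] at h1 ⊢
        generalize p g true e = x at *
        generalize p g false e = y at *
        revert x y; decide
  · by_cases hef : e = f
    · subst hef; exact Or.inr (Or.inl subset_rfl)
    by_cases heE : e ∈ E'
    · simp only [heE, if_true, Finset.disjoint_singleton_left, Finset.singleton_subset_iff]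
      tauto
    by_cases hfE : f ∈ E'
    · simp only [hfE, if_true, Finset.disjoint_singleton_right, Finset.singleton_subset_iff]
      tauto
    simp only [heE, hfE, if_false]
    rcases laminar_of_side_labels hW (hX he) (hX hf) heE hfE hef (hJ e he) (hJ f hf)
      (hp1' e he heE) (hp1' f hf hfE) hp2 hp3 with h | h | h
    · left
      rw [Finset.disjoint_left]
      intro x hx hx'
      simp only [Finset.mem_filter, Finset.mem_product] at hx hx'
      exact h x.1 (hE' hx.1.1) x.2 ⟨hx.2, hx'.2⟩
    · right; left
      intro x hx
      simp only [Finset.mem_filter, Finset.mem_product] at hx ⊢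
      exact ⟨hx.1, h x.1 (hE' hx.1.1) x.2 hx.2⟩
    · right; right
      intro x hx
      simp only [Finset.mem_filter, Finset.mem_product] at hx ⊢
      exact ⟨hx.1, h x.1 (hE' hx.1.1) x.2 hx.2⟩

/-! ### Walks and distances -/

section Walks

variable {V : Type*} {G K : SimpleGraph V} {w : Sym2 V → ℕ}

theorem wdist_le_walkWeight (hK : K ≤ G) {u v : V} (p : K.Walk u v) :
    wdist G w u v ≤ walkWeight w p := by
  refine (iInf_le _ (p.mapLe hK)).trans_eq ?_
  rw [walkWeight, walkWeight, SimpleGraph.Walk.edges_mapLe_eq_edges]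

theorem wdist_comm (u v : V) : wdist G w u v = wdist G w v u := by
  have key : ∀ u v : V, wdist G w u v ≤ wdist G w v u := by
    intro u v
    refine le_iInf fun p => (wdist_le_walkWeight le_rfl p.reverse).trans_eq ?_
    rw [walkWeight, walkWeight, SimpleGraph.Walk.edges_reverse, List.map_reverse,
      List.sum_reverse]
  exact le_antisymm (key u v) (key v u)

theorem walkWeight_eq_sum [DecidableEq V] {u v : V} {p : K.Walk u v} (hp : p.IsPath) :
    walkWeight w p = ∑ g ∈ p.edges.toFinset, w g := by
  rw [walkWeight, List.sum_toFinset _ hp.isTrail.edges_nodup]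

theorem subpath_edges {u v : V} (p : K.Walk u v) (i j : ℕ) :
    (subpath p i j).edges = (p.edges.drop i).take (j - i) := by
  rw [subpath, SimpleGraph.Walk.edges_take, SimpleGraph.Walk.edges_drop]

theorem isPath_subpath {u v : V} {p : K.Walk u v} (hp : p.IsPath) (i j : ℕ) :
    (subpath p i j).IsPath :=
  (hp.drop i).take _

theorem subpath_edges_subset {u v : V} (p : K.Walk u v) (i j : ℕ) :
    (subpath p i j).edges ⊆ p.edges := by
  rw [subpath_edges]
  exact fun g hg => List.mem_of_mem_drop (List.mem_of_mem_take hg)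

theorem parity_subpath [DecidableEq V] {u v : V} {p : K.Walk u v} (hp : p.IsPath) {i j : ℕ}
    (hij : i ≤ j) (x : V) :
    parity (subpath p i j).edges.toFinset x =
      (if x = p.getVert i then 1 else 0) + (if x = p.getVert j then 1 else 0) := by
  rw [parity_edges (isPath_subpath hp i j).isTrail.edges_nodup, SimpleGraph.Walk.drop_getVert,
    Nat.add_sub_cancel' hij]

theorem wdist_add_subpath_add_wdist_le (hK : K ≤ G) {u v : V} (p : K.Walk u v) {i j : ℕ}
    (hij : i ≤ j) :
    wdist G w u (p.getVert i) + (walkWeight w (subpath p i j) : ℝ≥0∞) +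
      wdist G w (p.getVert j) v ≤ walkWeight w p := by
  have h1 := wdist_le_walkWeight (w := w) hK (p.take i)
  have h2 := wdist_le_walkWeight (w := w) hK (p.drop j)
  have h3 : walkWeight w p = walkWeight w (p.take i) + walkWeight w (subpath p i j) +
      walkWeight w (p.drop j) := by
    simp only [walkWeight, subpath_edges, SimpleGraph.Walk.edges_take,
      SimpleGraph.Walk.edges_drop]
    rw [← List.sum_append, ← List.map_append, ← List.sum_append, ← List.map_append]
    have : p.edges.drop j = (p.edges.drop i).drop (j - i) := by
      rw [List.drop_drop, Nat.add_sub_cancel' hij]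
    rw [this, List.append_assoc, List.take_append_drop, List.take_append_drop]
  rw [h3]
  push_cast
  gcongr

variable [DecidableEq V] {E : Finset (Sym2 V)}

/-- If the union of two paths is acyclic, then the edges that they have in common, if any, form a
subpath of both. -/
theorem exists_subpath_edges_eq_inter {a b x y : V} {γ : K.Walk a b} {ρ : K.Walk x y}
    (hγ : γ.IsPath) (hρ : ρ.IsPath)
    (hacyc : ∀ B ⊆ γ.edges.toFinset ∪ ρ.edges.toFinset, parity B = 0 → B = ∅)
    (hne : (γ.edges.toFinset ∩ ρ.edges.toFinset).Nonempty) :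
    ∃ i j s t, i < j ∧ j ≤ ρ.length ∧ s ≤ t ∧
      (subpath ρ i j).edges.toFinset = γ.edges.toFinset ∩ ρ.edges.toFinset ∧
      (subpath γ s t).edges.toFinset = γ.edges.toFinset ∩ ρ.edges.toFinset ∧
      ((γ.getVert s = ρ.getVert i ∧ γ.getVert t = ρ.getVert j) ∨
        (γ.getVert s = ρ.getVert j ∧ γ.getVert t = ρ.getVert i)) := by
  -- `s` and `t` are the first and the last index at which `γ` is on `ρ`
  let T : Finset ℕ := {k ∈ Finset.range (γ.length + 1) | γ.getVert k ∈ ρ.support}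
  have hT : ∀ g ∈ γ.edges.toFinset ∩ ρ.edges.toFinset, ∃ k, k ∈ T ∧ k + 1 ∈ T ∧
      g = s(γ.getVert k, γ.getVert (k + 1)) ∧ ∃ hk : k < γ.edges.length, γ.edges[k] = g := by
    intro g hg
    rw [Finset.mem_inter, List.mem_toFinset, List.mem_toFinset] at hg
    obtain ⟨k, hk, rfl⟩ := List.mem_iff_getElem.1 hg.1
    have h1 := SimpleGraph.Walk.getElem_edges hk
    have h2 := hg.2
    rw [h1] at h2
    have hk' : k < γ.length := by rwa [SimpleGraph.Walk.length_edges] at hk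
    refine ⟨k, ?_, ?_, h1, hk, rfl⟩
    · exact Finset.mem_filter.2 ⟨by simp; omega, ρ.fst_mem_support_of_mem_edges h2⟩
    · exact Finset.mem_filter.2 ⟨by simp; omega, ρ.snd_mem_support_of_mem_edges h2⟩
  have hTne : T.Nonempty := by
    obtain ⟨g, hg⟩ := hne
    obtain ⟨k, hk, -⟩ := hT g hg
    exact ⟨k, hk⟩
  obtain ⟨s, hs, hsmin⟩ : ∃ s ∈ T, ∀ k ∈ T, s ≤ k :=
    ⟨T.min' hTne, T.min'_mem hTne, fun k hk => T.min'_le k hk⟩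
  obtain ⟨t, ht, htmax⟩ : ∃ t ∈ T, ∀ k ∈ T, k ≤ t :=
    ⟨T.max' hTne, T.max'_mem hTne, fun k hk => T.le_max' k hk⟩
  have hst : s ≤ t := hsmin t ht
  obtain ⟨i, hi, hil⟩ := SimpleGraph.Walk.mem_support_iff_exists_getVert.1
    (Finset.mem_filter.1 hs).2
  obtain ⟨j, hj, hjl⟩ := SimpleGraph.Walk.mem_support_iff_exists_getVert.1
    (Finset.mem_filter.1 ht).2
  have hsub : γ.edges.toFinset ∩ ρ.edges.toFinset ⊆ (subpath γ s t).edges.toFinset := by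
    intro g hg
    obtain ⟨k, hk1, hk2, -, hk, rfl⟩ := hT g hg
    have h1 := hsmin k hk1
    have h2 := htmax _ hk2
    rw [List.mem_toFinset, subpath_edges, List.mem_iff_getElem]
    refine ⟨k - s, ?_, ?_⟩
    · rw [List.length_take, List.length_drop]; omega
    · rw [List.getElem_take, List.getElem_drop]
      congr 1
      omega
  have key : ∀ i' j', i' ≤ j' → (∀ x, parity (subpath ρ i' j').edges.toFinset x =
      parity (subpath γ s t).edges.toFinset x) →
      (subpath ρ i' j').edges.toFinset = γ.edges.toFinset ∩ ρ.edges.toFinset ∧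
      (subpath γ s t).edges.toFinset = γ.edges.toFinset ∩ ρ.edges.toFinset ∧ i' < j' := by
    intro i' j' hij hpar
    have h1 : (subpath γ s t).edges.toFinset ⊆ γ.edges.toFinset := fun g hg => by
      rw [List.mem_toFinset] at *; exact subpath_edges_subset _ _ _ hg
    have h2 : (subpath ρ i' j').edges.toFinset ⊆ ρ.edges.toFinset := fun g hg => by
      rw [List.mem_toFinset] at *; exact subpath_edges_subset _ _ _ hg
    have h3 := hacyc (symmDiff (subpath γ s t).edges.toFinset (subpath ρ i' j').edges.toFinset)
      (by
        intro g hg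
        rcases Finset.mem_symmDiff.1 hg with h | h
        · exact Finset.mem_union_left _ (h1 h.1)
        · exact Finset.mem_union_right _ (h2 h.1))
      (by
        ext x
        rw [parity_symmDiff, hpar]
        exact CharTwo.add_self_eq_zero _)
    have h4 : (subpath γ s t).edges.toFinset = (subpath ρ i' j').edges.toFinset :=
      symmDiff_eq_bot.1 h3
    have h5 : (subpath γ s t).edges.toFinset = γ.edges.toFinset ∩ ρ.edges.toFinset :=
      (Finset.subset_inter h1 (h4 ▸ h2)).antisymm hsub
    refine ⟨h4 ▸ h5, h5, lt_of_le_of_ne hij ?_⟩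
    rintro rfl
    rw [h4, subpath_edges, Nat.sub_self, List.take_zero] at h5
    rw [← h5] at hne
    simp at hne
  rcases le_total i j with hij | hij
  · obtain ⟨h1, h2, h3⟩ := key i j hij fun x => by
      rw [parity_subpath hρ hij, parity_subpath hγ hst, hi, hj]
    exact ⟨i, j, s, t, h3, hjl, hst, h1, h2, Or.inl ⟨hi.symm, hj.symm⟩⟩
  · obtain ⟨h1, h2, h3⟩ := key j i hij fun x => by
      rw [parity_subpath hρ hij, parity_subpath hγ hst, hi, hj, add_comm]
    exact ⟨j, i, s, t, h3, hil, hst, h1, h2, Or.inr ⟨hi.symm, hj.symm⟩⟩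

/-- The minimum join of two distinct vertices is the set of edges of a shortest path. -/
theorem IsMinJoin.exists_isShortestPath [Fintype V] {φ : Sym2 V → ℕ} (hE : ∀ g, g ∈ E ↔ g ∈ K.edgeSet)
    {a b : V} (hab : a ≠ b) {J : Finset (Sym2 V)}
    (hJ : IsMinJoin (tieWeight w φ) E (parity {s(a, b)}) J) :
    ∃ p : K.Walk a b, IsShortestPath w p ∧ p.edges.toFinset = J := by
  obtain ⟨p, hp, hpJ⟩ := hJ.exists_path (K := K) (tieWeight_nonneg w φ) (fun g => (hE g).1) hab
  refine ⟨p, ⟨hp, le_antisymm (le_iInf fun q => ?_) (wdist_le_walkWeight le_rfl p)⟩, hpJ⟩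
  have h1 := hJ.sum_le (J' := q.bypass.edges.toFinset)
    (fun g hg => (hE g).2 (q.bypass.edges_subset_edgeSet (List.mem_toFinset.1 hg))) (by
      ext v
      rw [parity_edges q.bypass_isPath.isTrail.edges_nodup, parity_singleton hab])
  rw [← hpJ, ← walkWeight_eq_sum hp, ← walkWeight_eq_sum q.bypass_isPath] at h1
  have h2 : walkWeight w q.bypass ≤ walkWeight w q :=
    (q.edges_bypass_sublist_edges.map w).sum_le_sum fun _ _ => Nat.zero_le _
  exact_mod_cast h1.trans h2

theorem IsSpanner.exists_isMinJoin {t : ℝ} (hK : IsSpanner G w t K) {φ : Sym2 V → ℕ}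
    (hφ : Function.Injective φ) (hE : ∀ g, g ∈ E ↔ g ∈ K.edgeSet) {a b : V} (hab : G.Adj a b) :
    ∃ J, IsMinJoin (tieWeight w φ) E (parity {s(a, b)}) J := by
  have h1 : wdist K w a b < ⊤ := by
    refine (hK.2 a b).trans_lt (ENNReal.mul_lt_top ENNReal.ofReal_lt_top ?_)
    exact (wdist_le_walkWeight le_rfl hab.toWalk).trans_lt (ENNReal.natCast_lt_top _)
  obtain ⟨q, -⟩ := iInf_lt_iff.1 h1
  exact PlanarPruning.exists_isMinJoin hφ ⟨q.bypass.edges.toFinset,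
    fun g hg => (hE g).2 (q.bypass.edges_subset_edgeSet (List.mem_toFinset.1 hg)), by
      ext v
      rw [parity_edges q.bypass_isPath.isTrail.edges_nodup, parity_singleton hab.ne]⟩

end Walks


/-! ### Hanging edges -/

/-- If two thirds of the weight of an edge lies on common edges of its minimum join and a path `ρ`
that is a minimum join itself, then the edge is hanging on `ρ`, at the ends of the subpath formed
by the common edges. -/
theorem exists_isHangingAt {V : Type*} [Fintype V] [DecidableEq V] {G K : SimpleGraph V}
    {w φ : Sym2 V → ℕ} {ε : ℝ} (hK : IsSpanner G w (1 + ε) K) {E : Finset (Sym2 V)}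
    (hE : ∀ g, g ∈ E ↔ g ∈ K.edgeSet) {a b x y : V} (hab : a ≠ b)
    (hdist : wdist G w a b = w s(a, b)) (hpos : 0 < w s(a, b)) {t : V → ZMod 2}
    {J : Finset (Sym2 V)} (hJ : IsMinJoin (tieWeight w φ) E (parity {s(a, b)}) J)
    {ρ : K.Walk x y} (hρ : ρ.IsPath) (hρJ : IsMinJoin (tieWeight w φ) E t ρ.edges.toFinset)
    (hhang : 2 * w s(a, b) ≤ 3 * ∑ g ∈ J ∩ ρ.edges.toFinset, w g) :
    ∃ i j, IsHangingAt G w ε (2 / 3) ρ s(a, b) i j ∧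
      (subpath ρ i j).edges.toFinset = J ∩ ρ.edges.toFinset := by
  obtain ⟨γ, hγ, rfl⟩ := hJ.exists_isShortestPath hE hab
  have hne : (γ.edges.toFinset ∩ ρ.edges.toFinset).Nonempty := by
    rw [Finset.nonempty_iff_ne_empty]
    intro h
    rw [h] at hhang
    simp at hhang
    omega
  obtain ⟨i, j, s, t', hij, hj, hst, h1, h2, h3⟩ := exists_subpath_edges_eq_inter hγ.1 hρ
    (fun B hB hB0 => IsMinJoin.eq_empty_of_even (tieWeight_nonneg w φ) hJ hρJ hB hB0) hne
  refine ⟨i, j, ⟨hij, hj, ?_, ?_⟩, h1⟩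
  · rw [walkWeight_eq_sum (isPath_subpath hρ i j), h1]
    have : (2 : ℝ) * w s(a, b) ≤ 3 * (∑ g ∈ γ.edges.toFinset ∩ ρ.edges.toFinset, w g : ℕ) := by
      exact_mod_cast hhang
    linarith
  · have hγw : (walkWeight w γ : ℝ≥0∞) ≤ ENNReal.ofReal (1 + ε) * w s(a, b) := by
      rw [hγ.2, ← hdist]
      exact hK.2 a b
    have hsub : walkWeight w (subpath ρ i j) = walkWeight w (subpath γ s t') := by
      rw [walkWeight_eq_sum (isPath_subpath hρ i j), h1,
        walkWeight_eq_sum (isPath_subpath hγ.1 s t'), h2]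
    have h4 := (wdist_add_subpath_add_wdist_le (w := w) hK.1 γ hst).trans hγw
    rw [← hsub] at h4
    rcases h3 with ⟨h5, h6⟩ | ⟨h5, h6⟩
    · rw [h5, h6] at h4
      exact ⟨a, b, rfl, h4⟩
    · rw [h5, h6] at h4
      refine ⟨b, a, Sym2.eq_swap, ?_⟩
      rw [wdist_comm b, wdist_comm (ρ.getVert j)]
      refine le_trans (le_of_eq ?_) h4
      ring

theorem weight_coe {V : Type*} (w : Sym2 V → ℕ) (F : Finset (Sym2 V)) :
    weight w (F : Set (Sym2 V)) = ∑ e ∈ F, w e := by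
  rw [weight, finsum_mem_coe_finset]

end PlanarPruning

theorem mainTheorem4 {V : Type*} [Finite V]
    (G : SimpleGraph V) (hplanar : PlanarPruning.IsPlanar G) (hE : G.edgeSet.Nonempty)
    (w : Sym2 V → ℕ) (hw : ∀ e ∈ G.edgeSet, 0 < w e)
    (ε : ℝ) (hε : 0 < ε)
    (Gopt : SimpleGraph V) (hopt : PlanarPruning.IsMinWeightSpanner G w (1 + ε) Gopt)
    (H : SimpleGraph V) (hH : H ≤ G)
    (hHdist : ∀ u v : V, H.Adj u v → PlanarPruning.wdist G w u v = (w s(u, v) : ENNReal))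
    (Fnew Fold : Set (Sym2 V))
    (α : ℝ)
    (hα : α = (PlanarPruning.weight w (H.edgeSet \ (Fnew ∪ Fold)) : ℝ) /
      (PlanarPruning.weight w Gopt.edgeSet : ℝ)) :
    ∃ (x y : V) (ρ : Gopt.Walk x y) (F : Set (Sym2 V)) (i j : Sym2 V → ℕ),
      x ≠ y ∧ PlanarPruning.IsShortestPath w ρ ∧
      F ⊆ H.edgeSet \ (Fnew ∪ Fold) ∧
      (∀ e ∈ F, PlanarPruning.IsHangingAt G w ε (2 / 3) ρ e (i e) (j e)) ∧
      α / 6 * (PlanarPruning.walkWeight w ρ : ℝ) ≤ (PlanarPruning.weight w F : ℝ) ∧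
      PlanarPruning.IsLaminar
        ((fun e => (PlanarPruning.subpath ρ (i e) (j e)).edgeSet) '' F) := by
  classical
  have := Fintype.ofFinite V
  obtain ⟨φ, hφ⟩ := exists_injective_nat (Sym2 V)
  have hspan := hopt.1
  let E : Finset (Sym2 V) := G.edgeFinset
  let E' : Finset (Sym2 V) := Gopt.edgeFinset
  have hEmem : ∀ g, g ∈ E ↔ g ∈ G.edgeSet := fun g => SimpleGraph.mem_edgeFinset
  have hE'mem : ∀ g, g ∈ E' ↔ g ∈ Gopt.edgeSet := fun g => SimpleGraph.mem_edgeFinset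
  have hE'E : E' ⊆ E := SimpleGraph.edgeFinset_mono hspan.1
  obtain ⟨X, hX⟩ : ∃ X : Finset (Sym2 V), (X : Set (Sym2 V)) = H.edgeSet \ (Fnew ∪ Fold) :=
    ⟨(Set.toFinite _).toFinset, Set.Finite.coe_toFinset _⟩
  have hXH : ∀ e ∈ X, e ∈ H.edgeSet := fun e he => by
    have : e ∈ (X : Set (Sym2 V)) := he
    rw [hX] at this
    exact this.1
  have hXE : X ⊆ E := fun e he => (hEmem e).2 (SimpleGraph.edgeSet_mono hH (hXH e he))
  rw [← hX, ← SimpleGraph.coe_edgeFinset, PlanarPruning.weight_coe,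
    PlanarPruning.weight_coe] at hα
  rcases X.eq_empty_or_nonempty with hX0 | hXne
  · obtain ⟨e, he⟩ := hE
    induction e using Sym2.ind with
    | _ u v =>
      have huv : G.Adj u v := he
      obtain ⟨J, hJ⟩ := hspan.exists_isMinJoin hφ hE'mem huv
      obtain ⟨ρ, hρ, -⟩ := hJ.exists_isShortestPath hE'mem huv.ne
      refine ⟨u, v, ρ, ∅, fun _ => 0, fun _ => 0, huv.ne, hρ, by simp, by simp, ?_, ?_⟩
      · rw [hα, hX0]; simp
      · simp [PlanarPruning.IsLaminar]
  have hJex : ∀ e ∈ X, ∃ J, PlanarPruning.IsMinJoin (PlanarPruning.tieWeight w φ) E'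
      (PlanarPruning.parity {e}) J := by
    intro e he
    have h1 := (hEmem e).1 (hXE he)
    induction e using Sym2.ind with
    | _ a b => exact hspan.exists_isMinJoin hφ hE'mem h1
  choose! J hJ using hJex
  have hωJ : ∀ e ∈ X, w e ≤ ∑ g ∈ J e, w g := by
    intro e he
    have h1 := hXH e he
    have h2 := hJ e he
    induction e using Sym2.ind with
    | _ a b =>
      obtain ⟨p, hp, hpJ⟩ := h2.exists_isShortestPath hE'mem (H.ne_of_adj h1)
      rw [← hpJ, ← PlanarPruning.walkWeight_eq_sum hp.1]
      have h3 := PlanarPruning.wdist_le_walkWeight (w := w) hspan.1 p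
      rw [hHdist a b h1] at h3
      exact_mod_cast h3
  have hJself : ∀ e ∈ X, e ∈ E' → J e = {e} := by
    intro e he heE
    have h1 := hXH e he
    have h2 := hJ e he
    have h3 := hωJ e he
    induction e using Sym2.ind with
    | _ a b => exact h2.eq_singleton (H.ne_of_adj h1) heE h3
  obtain ⟨R, hR⟩ := hplanar.exists_regionSystem (PlanarPruning.tieWeight_nonneg w φ) hEmem hE'E hXE
    hJ hJself
  obtain ⟨f, hf, hfw⟩ := hR.exists_heavy hXne w w hωJ
  obtain ⟨x, y, ρ, hxy, hρ, hρJ⟩ : ∃ (x y : V) (ρ : Gopt.Walk x y), x ≠ y ∧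
      PlanarPruning.IsShortestPath w ρ ∧ ρ.edges.toFinset = J f := by
    have h1 := hXH f hf
    have h2 := hJ f hf
    induction f using Sym2.ind with
    | _ x y =>
      obtain ⟨ρ, hρ, hρJ⟩ := h2.exists_isShortestPath hE'mem (H.ne_of_adj h1)
      exact ⟨x, y, ρ, H.ne_of_adj h1, hρ, hρJ⟩
  have hhang : ∀ e ∈ X, PlanarPruning.Hangs J R w w e f → ∃ i j,
      PlanarPruning.IsHangingAt G w ε (2 / 3) ρ e i j ∧
      (PlanarPruning.subpath ρ i j).edges.toFinset = J e ∩ J f := by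
    intro e he hef
    have h1 := hXH e he
    have h2 := hJ e he
    have h3 := hw e ((hEmem e).1 (hXE he))
    have h4 := hef.2
    rw [← hρJ] at h4 ⊢
    induction e using Sym2.ind with
    | _ a b =>
      exact PlanarPruning.exists_isHangingAt hspan hE'mem (H.ne_of_adj h1) (hHdist a b h1) h3 h2
        hρ.1 (hρJ ▸ hJ f hf) h4
  choose! i j hij hijJ using hhang
  refine ⟨x, y, ρ, ((X.filter fun e => PlanarPruning.Hangs J R w w e f : Finset (Sym2 V)) :
    Set (Sym2 V)), i, j, hxy, hρ, ?_, ?_, ?_, ?_⟩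
  · rw [← hX]
    exact fun e he => (Finset.mem_filter.1 he).1
  · intro e he
    obtain ⟨h1, h2⟩ := Finset.mem_filter.1 (Finset.mem_coe.1 he)
    exact hij e h1 h2
  · rw [PlanarPruning.weight_coe, PlanarPruning.walkWeight_eq_sum hρ.1, hρJ, hα]
    have hpos : 0 < ∑ g ∈ E', w g := by
      have h1 := hωJ f hf
      have h2 := Finset.sum_le_sum_of_subset (f := w) (hJ f hf).1
      have h3 := hw f ((hEmem f).1 (hXE hf))
      omega
    have hpos' : (0 : ℝ) < (∑ g ∈ E', w g : ℕ) := by exact_mod_cast hpos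
    have hfw' : ((∑ e ∈ X, w e : ℕ) : ℝ) * (∑ g ∈ J f, w g : ℕ) ≤
        6 * (∑ g ∈ E', w g : ℕ) *
          (∑ e ∈ X with PlanarPruning.Hangs J R w w e f, w e : ℕ) := by
      exact_mod_cast hfw
    rw [div_div, div_mul_eq_mul_div, div_le_iff₀ (by positivity)]
    linarith
  · rintro _ ⟨e, he, rfl⟩ _ ⟨e', he', rfl⟩
    obtain ⟨h1, h2⟩ := Finset.mem_filter.1 (Finset.mem_coe.1 he)
    obtain ⟨h1', h2'⟩ := Finset.mem_filter.1 (Finset.mem_coe.1 he')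
    have hset : ∀ e ∈ X, PlanarPruning.Hangs J R w w e f →
        (PlanarPruning.subpath ρ (i e) (j e)).edgeSet = ((J e ∩ J f : Finset _) : Set _) := by
      intro e h1 h2
      ext g
      rw [← hijJ e h1 h2]
      simp
    simp only
    rw [hset e h1 h2, hset e' h1' h2', Finset.disjoint_coe, Finset.coe_subset, Finset.coe_subset]
    exact hR.inter_laminar h1 h1' hf h2.1 h2'.1
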